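/- Let $k=\mathbb F_q$ be a finite field, $K=\mathbb F_{q^d}$ an extension of degree $d\ge 1$, and $K\{\tau\}$ the skew polynomial ring with $\tau a=a^q\tau$ for $a\in K$; it is an algebra over its central subring $k[t]$, $t=\tau^d$. Let $p\in k[t]$ be irreducible with $p(0)\neq 0$, let $F=\mathbb F_q(t)_p$ be the completion of $k(t)$ at $p$ and $\mathcal O=\mathbb F_q[t]_p$ its valuation ring. Put $$\Gamma(1)=K\{\tau\}[\tfrac1p]^\times/k[t][\tfrac1p]^\times,\qquad \Gamma(\tau)=\ker\bigl(\Gamma(1)\to K^\times/k^\times\bigr),$$ the homomorphism being evaluation at $\tau=0$. There exist isomorphisms of $\mathcal O$-algebras $\Phi:\mathcal O\otimes_{k[t]}K\{\tau\}\cong M(d,\mathcal O)$; let $\Phi$ be any of them. Through $\Phi$ the group $\Gamma(1)$ acts on the affine building $X=X(F^d)$. Here the vertices of $X$ are the classes $\langle L\rangle$, modulo multiplication by $F^\times$, of the $\mathcal O$-lattices $L\subset F^d$, and its simplices are the sets $\{\langle L_0'\rangle,\dots,\langle L_r'\rangle\}$ for flags $L_0'\supsetneq\dots\supsetneq L_r'\supsetneq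 pL_0'$. An oriented edge $(\langle L'\rangle,\langle L''\rangle)$ with $L'\supsetneq L''\supsetneq pL'$ has the label $\dim_{\mathcal O/p}(L''/pL')\in\{1,\dots,d-1\}$. Let $L_0=\mathcal O^d$. For each lattice $L$ with $L_0\supsetneq L\supsetneq pL_0$ there is a unique $\gamma_L\in\Gamma(\tau)$ that is represented by a unit of $K\{\tau\}[\frac1p]$ lying in $K\{\tau\}$ and mapping $L_0$ onto $L$; it gets the label $\dim_{\mathcal O/p}(L/pL_0)$. Let $\mathrm{Cayley}(\Gamma(\tau);\{\gamma_L\})$ be the Cayley graph with edges $\gamma\to\gamma\gamma_L$, each carrying the label of $\gamma_L$, and with the simplicial (hypergraph) structure whose simplices are the nonempty finite sets of pairwise adjacent vertices. Then $\gamma\mapsto\gamma\langle L_0\rangle$ is an isomorphism of graphs from $\mathrm{Cayley}(\Gamma(\tau);\{\gamma_L\})$ onto the $1$-skeleton of $X$, which preserves labels and is an isomorphism of simplicial complexes. Let $\Gamma\subset\Gamma(\tau)$ be a normal subgroup of finite index, and let $\overline{\gamma_L}$ be the image of $\gamma_L$ in $\Gamma(\tau)/\Gamma$. Let $\Gamma\backslash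 X$ be the quotient complex, whose vertices are the $\Gamma$-orbits of vertices of $X$ and whose simplices are the images of the simplices of $X$; a pair of vertices of $\Gamma\backslash X$ carries a label if it is the image of an oriented edge of $X$ with this label (a pair may carry several labels, and its two members may coincide). Let $\mathrm{Cayley}(\Gamma(\tau)/\Gamma;\{\overline{\gamma_L}\})$ carry the labels of the $\gamma_L$ on its edges $g\to g\,\overline{\gamma_L}$ and, as its simplices, the images of the simplices of $\mathrm{Cayley}(\Gamma(\tau);\{\gamma_L\})$. Then the isomorphism above induces a bijection $$\Gamma(\tau)/\Gamma\longrightarrow\Gamma\backslash X_0,\qquad \gamma\Gamma\mapsto\Gamma\gamma\langle L_0\rangle,$$ which is an isomorphism of graphs from $\mathrm{Cayley}(\Gamma(\tau)/\Gamma;\{\overline{\gamma_L}\})$ onto the $1$-skeleton of $\Gamma\backslash X$, preserves labels, and is an isomorphism of the simplicial complexes (hypergraphs). -/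

import Mathlib

open Polynomial TensorProduct IsDedekindDomain

namespace SkewBuilding

noncomputable section

/-! ## Simplicial complexes, their graphs, quotients -/

section Complexes

variable {V W : Type*}

/-- The graph underlying a simplicial complex (its `1`-skeleton): two different vertices are
adjacent iff they form a `1`-simplex. -/
def oneSkeleton (X : PreAbstractSimplicialComplex V) : SimpleGraph V where
  Adj x y := x ≠ y ∧ ∃ s ∈ X.faces, (s : Set V) = {x, y}
  symm := ⟨fun x y h => ⟨h.1.symm, by rw [Set.pair_comm]; exact h.2⟩⟩
  loopless := ⟨fun _ h => h.1 rfl⟩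

/-- The simplicial structure (hypergraph) determined by a graph: its simplices are the nonempty
finite sets of pairwise adjacent vertices. -/
def cliqueComplex (G : SimpleGraph V) : PreAbstractSimplicialComplex V where
  faces := {s | s.Nonempty ∧ G.IsClique (s : Set V)}
  isRelLowerSet_faces := fun {_} h =>
    ⟨h.1, fun _ hts ht => ⟨ht, h.2.subset (Finset.coe_subset.mpr hts)⟩⟩

open Classical in
/-- The image of a simplicial complex under a map of vertices: the simplices are the images of
the simplices. For an orbit map this is the quotient complex. -/
def imageComplex (X : PreAbstractSimplicialComplex V) (f : V → W) :
    PreAbstractSimplicialComplex W :=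
  X.map f

/-- The image of a labelling of oriented edges under a map of vertices: the pair `(a, b)` carries
the label `i` iff it is the image of an oriented edge with label `i`. -/
def imageLabel (lab : V → V → ℕ → Prop) (f : V → W) (a b : W) (i : ℕ) : Prop :=
  ∃ x y, f x = a ∧ f y = b ∧ lab x y i

end Complexes

/-! ## Labels of Cayley graphs -/

/-- The labelled oriented edges of the Cayley graph of `G` with respect to generators that are
sorted by label (`S i` is the set of generators with label `i`): there is an edge with label `i`
from `g` to `g * s` for every `s ∈ S i`. -/
def cayleyLabel {G : Type*} [Mul G] (S : ℕ → Set G) (g h : G) (i : ℕ) : Prop :=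
  ∃ s ∈ S i, g * s = h

/-! ## The affine building of `F ^ n` -/

section Building

variable (O F : Type*) [CommRing O] [Field F] [Algebra O F] (n : ℕ)

/-- The `O`-lattices in `F ^ n`: the `O`-spans of the `F`-bases of `F ^ n`. -/
def Lattice : Type _ :=
  {L : Submodule O (Fin n → F) //
    ∃ b : Module.Basis (Fin n) F (Fin n → F), L = Submodule.span O (Set.range b)}

variable {O F n}

instance : PartialOrder (Lattice O F n) :=
  inferInstanceAs (PartialOrder {L : Submodule O (Fin n → F) //
    ∃ b : Module.Basis (Fin n) F (Fin n → F), L = Submodule.span O (Set.range b)})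

namespace Lattice

@[ext] lemma ext {L M : Lattice O F n} (h : L.1 = M.1) : L = M := Subtype.ext h

variable (O F n) in
/-- The standard lattice `O ^ n`. -/
def std : Lattice O F n :=
  ⟨Submodule.span O (Set.range (Pi.basisFun F (Fin n))), Pi.basisFun F (Fin n), rfl⟩

/-- The image of a lattice under an `F`-linear automorphism of `F ^ n`. -/
def map (e : (Fin n → F) ≃ₗ[F] (Fin n → F)) (L : Lattice O F n) : Lattice O F n :=
  ⟨L.1.map ((e : (Fin n → F) →ₗ[F] (Fin n → F)).restrictScalars O), by
    obtain ⟨b, hb⟩ := L.2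
    refine ⟨b.map e, ?_⟩
    rw [hb, Submodule.map_span, ← Set.range_comp]
    rfl⟩

lemma mem_map {e : (Fin n → F) ≃ₗ[F] (Fin n → F)} {L : Lattice O F n} {x : Fin n → F} :
    x ∈ (L.map e).1 ↔ ∃ y ∈ L.1, e y = x := Submodule.mem_map

/-- The lattice `c L = {c x | x ∈ L}`, for `c ∈ Fˣ`. -/
def scale (c : Fˣ) (L : Lattice O F n) : Lattice O F n :=
  L.map (LinearEquiv.smulOfUnit c)

/-- The action `g L = {g x | x ∈ L}` of `GL (n, F)` on lattices. -/
instance : MulAction (GL (Fin n) F) (Lattice O F n) where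
  smul g L := L.map (LinearMap.GeneralLinearGroup.generalLinearEquiv F (Fin n → F)
    (Matrix.GeneralLinearGroup.toLin g))
  one_smul L := by
    apply Lattice.ext
    ext x
    refine mem_map.trans ?_
    simp
  mul_smul g h L := by
    apply Lattice.ext
    ext x
    refine mem_map.trans (Iff.trans ?_ mem_map.symm)
    constructor
    · rintro ⟨y, hy, rfl⟩
      refine ⟨_, mem_map.mpr ⟨y, hy, rfl⟩, ?_⟩
      simp
    · rintro ⟨z, hz, rfl⟩
      obtain ⟨y, hy, rfl⟩ := mem_map.mp hz
      refine ⟨y, hy, ?_⟩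
      simp

lemma mem_smul {g : GL (Fin n) F} {L : Lattice O F n} {x : Fin n → F} :
    x ∈ (g • L).1 ↔ ∃ y ∈ L.1, g.1.mulVec y = x := Submodule.mem_map

lemma mem_scale {c : Fˣ} {L : Lattice O F n} {x : Fin n → F} :
    x ∈ (L.scale c).1 ↔ ∃ y ∈ L.1, (c : F) • y = x := Submodule.mem_map

lemma scale_scale (b c : Fˣ) (L : Lattice O F n) : (L.scale c).scale b = L.scale (b * c) := by
  apply Lattice.ext
  ext x
  simp only [mem_scale]
  constructor
  · rintro ⟨_, ⟨y, hy, rfl⟩, rfl⟩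
    exact ⟨y, hy, by simp [mul_smul]⟩
  · rintro ⟨y, hy, rfl⟩
    exact ⟨_, ⟨y, hy, rfl⟩, by simp [mul_smul]⟩

lemma scale_one (L : Lattice O F n) : L.scale 1 = L := by
  apply Lattice.ext
  ext x
  simp [mem_scale]

lemma smul_scale (g : GL (Fin n) F) (c : Fˣ) (L : Lattice O F n) :
    g • L.scale c = (g • L).scale c := by
  apply Lattice.ext
  ext x
  simp only [mem_scale, mem_smul]
  constructor
  · rintro ⟨_, ⟨y, hy, rfl⟩, rfl⟩
    exact ⟨_, ⟨y, hy, rfl⟩, by simp [Matrix.mulVec_smul]⟩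
  · rintro ⟨_, ⟨y, hy, rfl⟩, rfl⟩
    exact ⟨_, ⟨y, hy, rfl⟩, by simp [Matrix.mulVec_smul]⟩

variable (O F n) in
/-- Two lattices are similar iff one is a multiple of the other by an element of `Fˣ`. -/
def similar : Setoid (Lattice O F n) where
  r L M := ∃ c : Fˣ, M = L.scale c
  iseqv :=
    { refl := fun L => ⟨1, L.scale_one.symm⟩
      symm := by
        rintro L _ ⟨c, rfl⟩
        exact ⟨c⁻¹, by rw [scale_scale, inv_mul_cancel, scale_one]⟩
      trans := by
        rintro L _ _ ⟨c, rfl⟩ ⟨b, rfl⟩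
        exact ⟨b * c, by rw [scale_scale]⟩ }

end Lattice

variable (O F n) in
/-- The vertices of the building: lattices up to similarity. -/
def Vertex : Type _ := Quotient (Lattice.similar O F n)

namespace Vertex

/-- The vertex `⟨L⟩` of a lattice `L`. -/
def mk (L : Lattice O F n) : Vertex O F n := Quotient.mk (Lattice.similar O F n) L

/-- The action of `GL (n, F)` on the vertices: `g ⟨L⟩ = ⟨g L⟩`. -/
instance : MulAction (GL (Fin n) F) (Vertex O F n) where
  smul g := Quotient.map (g • ·) (by
    rintro L _ ⟨c, rfl⟩
    exact ⟨c, Lattice.smul_scale g c L⟩)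
  one_smul x := by
    induction x using Quotient.inductionOn with
    | h L => exact congrArg (Quotient.mk _) (one_smul _ L)
  mul_smul g h x := by
    induction x using Quotient.inductionOn with
    | h L => exact congrArg (Quotient.mk _) (mul_smul g h L)

lemma smul_mk (g : GL (Fin n) F) (L : Lattice O F n) : g • mk L = mk (g • L) := rfl

end Vertex

/-- The affine building of `F ^ n`, where `π` is a uniformizer of `O`: the simplices are the sets
`{⟨L₀⟩, …, ⟨Lᵣ⟩}` for the flags of lattices `L₀ ⊋ L₁ ⊋ ⋯ ⊋ Lᵣ ⊋ π L₀`. -/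
def building (π : Fˣ) : PreAbstractSimplicialComplex (Vertex O F n) where
  faces := {s | ∃ (r : ℕ) (L : Fin (r + 1) → Lattice O F n), StrictAnti L ∧
    (L 0).scale π < L (Fin.last r) ∧ (s : Set (Vertex O F n)) = Set.range (Vertex.mk ∘ L)}
  isRelLowerSet_faces := by
    classical
    rintro s ⟨r, L, hL, hπ, hs⟩
    refine ⟨?_, fun t hts ht => ?_⟩
    · rw [← Finset.coe_nonempty, hs]
      exact Set.range_nonempty _
    · let I : Finset (Fin (r + 1)) := Finset.univ.filter fun i => Vertex.mk (L i) ∈ t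
      have hI : I.Nonempty := by
        obtain ⟨x, hx⟩ := ht
        have : x ∈ (s : Set (Vertex O F n)) := hts hx
        rw [hs] at this
        obtain ⟨i, rfl⟩ := this
        exact ⟨i, by simpa [I] using hx⟩
      obtain ⟨m, hm⟩ : ∃ m, I.card = m + 1 :=
        ⟨I.card - 1, (Nat.succ_pred_eq_of_pos hI.card_pos).symm⟩
      refine ⟨m, L ∘ I.orderEmbOfFin hm, hL.comp_strictMono (I.orderEmbOfFin hm).strictMono,
        ?_, ?_⟩
      · have h1 : (L (I.orderEmbOfFin hm 0)).scale π ≤ (L 0).scale π :=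
          Submodule.map_mono (hL.antitone (Fin.zero_le _))
        exact lt_of_le_of_lt h1 (lt_of_lt_of_le hπ (hL.antitone (Fin.le_last _)))
      · ext x
        constructor
        · intro hx
          have : x ∈ (s : Set (Vertex O F n)) := hts hx
          rw [hs] at this
          obtain ⟨i, rfl⟩ := this
          have hi : i ∈ I := by simpa [I] using hx
          have : i ∈ Set.range (I.orderEmbOfFin hm) := by
            rw [Finset.range_orderEmbOfFin]; exact hi
          obtain ⟨j, rfl⟩ := this
          exact ⟨j, rfl⟩
        · rintro ⟨j, rfl⟩
          exact (Finset.mem_filter.mp (I.orderEmbOfFin_mem hm j)).2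

/-- The lattice `M` lies strictly between `π L` and `L`, so that `⟨L, M⟩` is a `1`-simplex. -/
def IsNeighbor (π : Fˣ) (L M : Lattice O F n) : Prop :=
  M < L ∧ L.scale π < M

/-- The label of a neighboring lattice `M` of `L` (where `π L ⊊ M ⊊ L`): the dimension of the
subspace `M / π L` of `L / π L` over the residue field. As `M / π L` is killed by `π`, this is its
length as an `O`-module. -/
def latticeLabel (π : Fˣ) (L M : Lattice O F n) : ℕ∞ :=
  Module.length O (M.1 ⧸ (L.scale π).1.submoduleOf M.1)

/-- The (local) labels of the building: the oriented edge from `x` to `y` has the label `i` iff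
`x = ⟨L⟩` and `y = ⟨M⟩` with `L ⊋ M ⊋ π L` and `dim (M / π L) = i`. -/
def buildingLabel (π : Fˣ) (x y : Vertex O F n) (i : ℕ) : Prop :=
  ∃ L M : Lattice O F n, Vertex.mk L = x ∧ Vertex.mk M = y ∧ IsNeighbor π L M ∧
    latticeLabel π L M = i

end Building

/-! ## The ring `K{τ}` of skew polynomials, where `K / k` is an extension of finite fields -/

section Skew

/-- The constant coefficient of skew polynomials is multiplicative. -/
lemma skewPolynomial_coeff_zero_mul {R : Type*} [Ring R] [MulSemiringAction (Multiplicative ℕ) R]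
    (f g : SkewPolynomial R) : (f * g).coeff 0 = f.coeff 0 * g.coeff 0 := by
  induction f using SkewPolynomial.induction with
  | h0 => simp
  | ha m a f _ _ hf =>
    rw [add_mul, SkewPolynomial.coeff_add, SkewPolynomial.coeff_add, hf, add_mul]
    congr 1
    clear hf
    induction g using SkewPolynomial.induction with
    | h0 => simp
    | ha l b g _ _ hg =>
      rw [mul_add, SkewPolynomial.coeff_add, SkewPolynomial.coeff_add, mul_add]
      congr 1
      · rw [SkewPolynomial.monomial_mul_monomial]
        simp only [SkewPolynomial.coeff_monomial]
        rcases m with _ | m <;> rcases l with _ | l <;> simp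

variable (k K : Type*) [Field k] [Fintype k] [Field K] [Algebra k K]

/-- The powers of the Frobenius `a ↦ a ^ q`, `q = #k`, acting on `K`. -/
@[reducible] def frobeniusAction : MulSemiringAction (Multiplicative ℕ) K :=
  MulSemiringAction.compHom K (powersHom (K →+* K) (FiniteField.frobeniusAlgHom k K).toRingHom)

/-- The ring `K{τ}` of skew polynomials, with `τ a = a ^ q τ` for `a ∈ K`, where `q = #k`. -/
def SkewPoly (k K : Type*) [Field k] [Fintype k] [Field K] [Algebra k K] : Type _ :=
  SkewPolynomial K

namespace SkewPoly

instance : Ring (SkewPoly k K) :=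
  letI := frobeniusAction k K
  inferInstanceAs (Ring (SkewPolynomial K))

/-- The constants `K → K{τ}`. -/
def C : K →+* SkewPoly k K :=
  letI := frobeniusAction k K
  (SkewPolynomial.CRingHom : K →+* SkewPolynomial K)

/-- The indeterminate `τ`. -/
def τ : SkewPoly k K := (SkewPolynomial.X : SkewPolynomial K)

lemma frobenius_iterate (m : ℕ) (a : K) :
    letI := frobeniusAction k K
    (SkewPolynomial.φ (R := K))^[m] a = a ^ Fintype.card k ^ m := by
  let := frobeniusAction k K
  induction m with
  | zero => simp
  | succ m ih =>
    rw [Function.iterate_succ_apply', ih]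
    change (FiniteField.frobeniusAlgHom k K) _ = _
    simp [FiniteField.frobeniusAlgHom_apply, pow_succ, pow_mul]

/-- The rule `τ a = a ^ q τ`. -/
lemma τ_mul_C (a : K) : τ k K * C k K a = C k K (a ^ Fintype.card k) * τ k K := by
  let := frobeniusAction k K
  have h : SkewPolynomial.monomial 1 1 * SkewPolynomial.C a
      = SkewPolynomial.C (a ^ Fintype.card k) * SkewPolynomial.monomial 1 1 := by
    rw [SkewPolynomial.monomial_mul_C, SkewPolynomial.C_mul_monomial, frobenius_iterate]
    simp
  exact h

lemma τ_pow_mul_C (m : ℕ) (a : K) :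
    τ k K ^ m * C k K a = C k K (a ^ Fintype.card k ^ m) * τ k K ^ m := by
  induction m generalizing a with
  | zero => simp
  | succ m ih => rw [pow_succ, mul_assoc, τ_mul_C, ← mul_assoc, ih, mul_assoc, ← pow_mul, pow_succ']

/-- Every skew polynomial is a sum of terms `a τ ^ m`. -/
lemma induction_on {P : SkewPoly k K → Prop} (f : SkewPoly k K) (zero : P 0)
    (add : ∀ f g, P f → P g → P (f + g)) (term : ∀ a m, P (C k K a * τ k K ^ m)) : P f := by
  let := frobeniusAction k K
  refine SkewPolynomial.induction (R := K) (motive := P) f zero fun m a g _ _ hg => ?_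
  refine add _ _ ?_ hg
  rw [← SkewPolynomial.C_mul_X_pow_eq_monomial]
  exact term a m

lemma commute_of_terms {z : SkewPoly k K} (hC : ∀ a, Commute z (C k K a))
    (hτ : Commute z (τ k K)) (f : SkewPoly k K) : Commute z f := by
  induction f using induction_on with
  | zero => exact Commute.zero_right z
  | add f g hf hg => exact hf.add_right hg
  | term a m => exact (hC a).mul_right (hτ.pow_right m)

/-- `K{τ}` as an algebra over `k`. -/
instance : Algebra k (SkewPoly k K) :=
  RingHom.toAlgebra' ((C k K).comp (algebraMap k K)) fun c f => by
    refine commute_of_terms k K (fun a => ?_) ?_ f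
    · rw [RingHom.comp_apply, Commute, SemiconjBy, ← map_mul, ← map_mul, mul_comm]
    · rw [RingHom.comp_apply, Commute, SemiconjBy, τ_mul_C, ← map_pow, FiniteField.pow_card]

/-- The constant coefficient `K{τ} → K`, that is, evaluation at `τ = 0`. -/
def evalZero : SkewPoly k K →+* K :=
  letI := frobeniusAction k K
  { toFun := fun f => SkewPolynomial.coeff (R := K) f 0
    map_zero' := rfl
    map_one' := SkewPolynomial.coeff_one_zero
    map_add' := fun f g => SkewPolynomial.coeff_add (R := K) f g 0
    map_mul' := fun f g => skewPolynomial_coeff_zero_mul (R := K) f g }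

lemma evalZero_C (a : K) : evalZero k K (C k K a) = a := SkewPolynomial.coeff_C_zero

lemma evalZero_τ : evalZero k K (τ k K) = 0 := SkewPolynomial.coeff_X_zero

variable [FiniteDimensional k K]

/-- `t = τ ^ d` is central, where `d = [K : k]`. -/
lemma τ_pow_finrank_commute (f : SkewPoly k K) : Commute (τ k K ^ Module.finrank k K) f := by
  refine commute_of_terms k K (fun a => ?_) ?_ f
  · have : Finite K := Module.finite_of_finite k
    let := Fintype.ofFinite K
    rw [Commute, SemiconjBy, τ_pow_mul_C, ← Module.card_eq_pow_finrank (K := k) (V := K),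
      FiniteField.pow_card]
  · exact Commute.pow_left rfl _

/-- `K{τ}` as an algebra over `k[t]`, via `t = τ ^ d` with `d = [K : k]`. -/
instance : Algebra k[X] (SkewPoly k K) :=
  RingHom.toAlgebra' (aeval (τ k K ^ Module.finrank k K) : k[X] →ₐ[k] SkewPoly k K).toRingHom
    fun g f => by
      change Commute (aeval (τ k K ^ Module.finrank k K) g) f
      induction g using Polynomial.induction_on' with
      | add g h hg hh => rw [map_add]; exact hg.add_left hh
      | monomial m c =>
        rw [aeval_monomial]
        exact (Algebra.commute_algebraMap_left c f).mul_left
          ((τ_pow_finrank_commute k K f).pow_left m)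

lemma algebraMap_X : algebraMap k[X] (SkewPoly k K) X = τ k K ^ Module.finrank k K :=
  aeval_X _

lemma algebraMap_C (c : k) : algebraMap k[X] (SkewPoly k K) (Polynomial.C c)
    = C k K (algebraMap k K c) :=
  aeval_C _ _

lemma evalZero_algebraMap (g : k[X]) :
    evalZero k K (algebraMap k[X] (SkewPoly k K) g) = algebraMap k K (g.eval 0) := by
  induction g using Polynomial.induction_on' with
  | add g h hg hh => simp only [map_add, hg, hh, eval_add]
  | monomial m c =>
    rw [← C_mul_X_pow_eq_monomial, map_mul, map_pow, algebraMap_C, algebraMap_X, map_mul, map_pow,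
      map_pow, evalZero_C, evalZero_τ, zero_pow Module.finrank_pos.ne']
    simp

end SkewPoly

end Skew

/-! ## The arithmetic groups -/

section Arithmetic

variable (k K : Type*) [Field k] [Fintype k] [Field K] [Algebra k K] [FiniteDimensional k K]
variable (p : k[X])

/-- The ring `K{τ}[1/p] = k[t][1/p] ⊗ K{τ}` (tensor product over `k[t]`). -/
abbrev LocSkewPoly : Type _ := Localization.Away p ⊗[k[X]] SkewPoly k K

/-- The central subgroup `Z = k[t][1/p]ˣ` of `K{τ}[1/p]ˣ`. -/
def centralUnits : Subgroup (LocSkewPoly k K p)ˣ :=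
  (Units.map (algebraMap (Localization.Away p) (LocSkewPoly k K p)).toMonoidHom).range

lemma mem_centralUnits {u : (LocSkewPoly k K p)ˣ} : u ∈ centralUnits k K p ↔
    ∃ c : (Localization.Away p)ˣ, algebraMap (Localization.Away p) (LocSkewPoly k K p) c = u := by
  refine exists_congr fun c => ?_
  rw [Units.ext_iff]
  rfl

instance : (centralUnits k K p).Normal where
  conj_mem u hu g := by
    obtain ⟨c, hc⟩ := (mem_centralUnits k K p).mp hu
    have : g * u * g⁻¹ = u := by
      rw [mul_inv_eq_iff_eq_mul]
      apply Units.ext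
      rw [Units.val_mul, Units.val_mul, ← hc]
      exact (Algebra.commutes _ _).symm
    rwa [this]

/-- `Γ(1) = K{τ}[1/p]ˣ / Z`. -/
abbrev GammaOne : Type _ := (LocSkewPoly k K p)ˣ ⧸ centralUnits k K p

/-- The image of `kˣ` in `Kˣ`. -/
def baseUnits : Subgroup Kˣ := (Units.map (algebraMap k K).toMonoidHom).range

variable {p}

/-- The evaluation `k[t][1/p] → k` at `t = 0`, for `p(0) ≠ 0`. -/
def locEvalZero (hp0 : p.eval 0 ≠ 0) : Localization.Away p →+* k :=
  IsLocalization.Away.lift p (g := evalRingHom 0) (isUnit_iff_ne_zero.mpr hp0)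

/-- The evaluation `K{τ}[1/p] → K` at `τ = 0`, for `p(0) ≠ 0`: the constant coefficient of the
expansion of an element of `K{τ}[1/p]` as a skew power series in `τ`. -/
def skewEvalZero (hp0 : p.eval 0 ≠ 0) : LocSkewPoly k K p →+* K :=
  letI : Algebra k[X] K := ((algebraMap k K).comp (evalRingHom 0)).toAlgebra
  (Algebra.TensorProduct.lift
    ({ (algebraMap k K).comp (locEvalZero k hp0) with
        commutes' := fun g => congrArg (algebraMap k K)
          (IsLocalization.Away.lift_eq p (isUnit_iff_ne_zero.mpr hp0) g) } :
      Localization.Away p →ₐ[k[X]] K)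
    ({ SkewPoly.evalZero k K with
        commutes' := fun g => SkewPoly.evalZero_algebraMap k K g } : SkewPoly k K →ₐ[k[X]] K)
    (fun _ _ => Commute.all _ _)).toRingHom

lemma skewEvalZero_tmul (hp0 : p.eval 0 ≠ 0) (c : Localization.Away p) (f : SkewPoly k K) :
    skewEvalZero k K hp0 (c ⊗ₜ f)
      = algebraMap k K (locEvalZero k hp0 c) * SkewPoly.evalZero k K f := rfl

lemma skewEvalZero_central (hp0 : p.eval 0 ≠ 0) :
    centralUnits k K p ≤ (baseUnits k K).comap (Units.map (skewEvalZero k K hp0).toMonoidHom) := by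
  intro u hu
  obtain ⟨c, hc⟩ := (mem_centralUnits k K p).mp hu
  refine ⟨Units.map (locEvalZero k hp0).toMonoidHom c, ?_⟩
  apply Units.ext
  change _ = skewEvalZero k K hp0 u
  rw [← hc]
  change _ = skewEvalZero k K hp0 ((c : Localization.Away p) ⊗ₜ 1)
  rw [skewEvalZero_tmul, map_one, mul_one]
  rfl

/-- The homomorphism `Γ(1) → Kˣ / kˣ` given by evaluation at `τ = 0`. -/
def gammaEvalZero (hp0 : p.eval 0 ≠ 0) : GammaOne k K p →* Kˣ ⧸ baseUnits k K :=
  QuotientGroup.map _ _ (Units.map (skewEvalZero k K hp0).toMonoidHom)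
    (skewEvalZero_central k K hp0)

/-- `Γ(τ)`, the kernel of `Γ(1) → Kˣ / kˣ`. -/
def GammaTau (hp0 : p.eval 0 ≠ 0) : Subgroup (GammaOne k K p) := (gammaEvalZero k K hp0).ker

/-! ## The local situation at `p` -/

/-- The place of `k(t)` given by the irreducible polynomial `p`. -/
def place {k : Type*} [Field k] {p : k[X]} (hp : Irreducible p) : HeightOneSpectrum k[X] where
  asIdeal := Ideal.span {p}
  isPrime := (Ideal.span_singleton_prime hp.ne_zero).mpr hp.prime
  ne_bot := by simpa using hp.ne_zero

/-- The completion `k(t)_p` of `k(t)` at `p`. -/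
abbrev LocalField {k : Type*} [Field k] {p : k[X]} (hp : Irreducible p) : Type _ :=
  (place hp).adicCompletion (RatFunc k)

/-- The valuation ring `k[t]_p` of `k(t)_p`. -/
abbrev LocalRing {k : Type*} [Field k] {p : k[X]} (hp : Irreducible p) : Type _ :=
  (place hp).adicCompletionIntegers (RatFunc k)

/-- The isomorphisms `k[t]_p ⊗ K{τ} ≅ M(d, k[t]_p)` of `k[t]_p`-algebras (tensor product over
`k[t]`), where `d = [K : k]`. -/
abbrev LocalSplitting (hp : Irreducible p) : Type _ :=
  (LocalRing hp ⊗[k[X]] SkewPoly k K) ≃ₐ[LocalRing hp]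
    Matrix (Fin (Module.finrank k K)) (Fin (Module.finrank k K)) (LocalRing hp)

lemma algebraMap_local_ne_zero {k : Type*} [Field k] {p : k[X]} (hp : Irreducible p) :
    algebraMap k[X] (LocalField hp) p ≠ 0 := by
  rw [IsScalarTower.algebraMap_apply k[X] (RatFunc k) (LocalField hp), Ne, map_eq_zero,
    FaithfulSMul.algebraMap_eq_zero_iff]
  exact hp.ne_zero

/-- The uniformizer `p` of `k(t)_p`. -/
def unif {k : Type*} [Field k] {p : k[X]} (hp : Irreducible p) : (LocalField hp)ˣ :=
  Units.mk0 (algebraMap k[X] (LocalField hp) p) (algebraMap_local_ne_zero hp)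

/-- The inclusion `k[t][1/p] → k(t)_p`. -/
def locToLocal {k : Type*} [Field k] {p : k[X]} (hp : Irreducible p) :
    Localization.Away p →ₐ[k[X]] LocalField hp :=
  IsLocalization.Away.liftAlgHom p (f := Algebra.ofId k[X] (LocalField hp))
    (isUnit_iff_ne_zero.mpr (algebraMap_local_ne_zero hp))

variable {k K} {hp : Irreducible p} (Φ : LocalSplitting k K hp)

/-- The embedding `K{τ} → M(d, k(t)_p)` given by `Φ`. -/
def skewToMatrix : SkewPoly k K →ₐ[k[X]]
    Matrix (Fin (Module.finrank k K)) (Fin (Module.finrank k K)) (LocalField hp) :=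
  ((IsScalarTower.toAlgHom k[X] (LocalRing hp) (LocalField hp)).mapMatrix.comp
    (Φ.toAlgHom.restrictScalars k[X])).comp Algebra.TensorProduct.includeRight

/-- The scalars `k[t][1/p] → M(d, k(t)_p)`. -/
def locScalar (d : ℕ) (hp : Irreducible p) :
    Localization.Away p →ₐ[k[X]] Matrix (Fin d) (Fin d) (LocalField hp) :=
  ((Algebra.ofId (LocalField hp) (Matrix (Fin d) (Fin d) (LocalField hp))).restrictScalars
    k[X]).comp (locToLocal hp)

/-- The homomorphism `K{τ}[1/p] → M(d, k(t)_p)` given by `Φ`. -/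
def locSkewToMatrix : LocSkewPoly k K p →ₐ[k[X]]
    Matrix (Fin (Module.finrank k K)) (Fin (Module.finrank k K)) (LocalField hp) :=
  Algebra.TensorProduct.lift (S := k[X]) (locScalar (Module.finrank k K) hp) (skewToMatrix Φ)
    (fun c f => Algebra.commutes (locToLocal hp c) (skewToMatrix Φ f))

lemma locSkewToMatrix_tmul (c : Localization.Away p) (f : SkewPoly k K) :
    locSkewToMatrix Φ (c ⊗ₜ f) = algebraMap _ _ (locToLocal hp c) * skewToMatrix Φ f := rfl

/-- The homomorphism `K{τ}[1/p]ˣ → GL (d, k(t)_p)` given by `Φ`. -/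
def unitsToGL : (LocSkewPoly k K p)ˣ →* GL (Fin (Module.finrank k K)) (LocalField hp) :=
  Units.map (locSkewToMatrix Φ).toRingHom.toMonoidHom

/-- The lattices in `k(t)_p ^ d`. -/
abbrev Lat (k K : Type*) [Field k] [Field K] [Algebra k K] {p : k[X]} (hp : Irreducible p) :
    Type _ :=
  Lattice (LocalRing hp) (LocalField hp) (Module.finrank k K)

/-- The vertices of the building of `k(t)_p ^ d`. -/
abbrev Vert (k K : Type*) [Field k] [Field K] [Algebra k K] {p : k[X]} (hp : Irreducible p) :
    Type _ :=
  Vertex (LocalRing hp) (LocalField hp) (Module.finrank k K)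

/-- The standard lattice `L₀`. -/
abbrev stdLat (k K : Type*) [Field k] [Field K] [Algebra k K] {p : k[X]} (hp : Irreducible p) :
    Lat k K hp :=
  Lattice.std (LocalRing hp) (LocalField hp) (Module.finrank k K)

/-- The affine building of `k(t)_p ^ d`. -/
abbrev bldg (k K : Type*) [Field k] [Field K] [Algebra k K] {p : k[X]} (hp : Irreducible p) :
    PreAbstractSimplicialComplex (Vert k K hp) :=
  building (unif hp)

lemma unitsToGL_central_smul (u : (LocSkewPoly k K p)ˣ) (hu : u ∈ centralUnits k K p)
    (x : Vert k K hp) : unitsToGL Φ u • x = x := by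
  obtain ⟨c, hc⟩ := (mem_centralUnits k K p).mp hu
  induction x using Quotient.inductionOn with
  | h L =>
    refine Quotient.sound ?_
    refine (Lattice.similar _ _ _).symm ⟨Units.map (locToLocal hp).toRingHom.toMonoidHom c, ?_⟩
    apply Lattice.ext
    ext x
    rw [Lattice.mem_smul, Lattice.mem_scale]
    refine exists_congr fun y => and_congr_right fun _ => ?_
    have h : (unitsToGL Φ u).1 = algebraMap _ _ (locToLocal hp c) := by
      change locSkewToMatrix Φ u = _
      rw [← hc]
      change locSkewToMatrix Φ ((c : Localization.Away p) ⊗ₜ 1) = _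
      rw [locSkewToMatrix_tmul, map_one, mul_one]
    rw [h, Algebra.algebraMap_eq_smul_one, Matrix.smul_mulVec, Matrix.one_mulVec]
    rfl

/-- The action of `Γ(1)` on the vertices of the building that is given by `Φ`. -/
def gammaAct : GammaOne k K p →* Equiv.Perm (Vert k K hp) :=
  QuotientGroup.lift (centralUnits k K p) ((MulAction.toPermHom _ _).comp (unitsToGL Φ))
    fun u hu => Equiv.ext fun x => unitsToGL_central_smul Φ u hu x

lemma gammaAct_mk (u : (LocSkewPoly k K p)ˣ) (L : Lat k K hp) :
    gammaAct Φ (u : GammaOne k K p) (Vertex.mk L) = Vertex.mk (unitsToGL Φ u • L) := rfl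

/-! ## The generators `γ_L` and the quotients -/

variable {hp0 : p.eval 0 ≠ 0}

/-- `γ = γ_L`: the element `γ ∈ Γ(τ)` is the class of a unit of `K{τ}[1/p]` that lies in `K{τ}`
and maps the standard lattice `L₀` onto `L`. -/
def IsGamma (L : Lat k K hp) (γ : GammaTau k K hp0) : Prop :=
  ∃ (u : (LocSkewPoly k K p)ˣ) (f : SkewPoly k K), (u : GammaOne k K p) = γ ∧
    (u : LocSkewPoly k K p) = 1 ⊗ₜ f ∧ unitsToGL Φ u • stdLat k K hp = L

variable (hp0) in
/-- The generators `γ_L`, where `L` runs through the lattices with `L₀ ⊋ L ⊋ p L₀`. -/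
def gens : Set (GammaTau k K hp0) :=
  {γ | ∃ L, IsNeighbor (unif hp) (stdLat k K hp) L ∧ IsGamma Φ L γ}

variable (hp0) in
/-- The generators `γ_L` with label `i`, that is, with `dim (L / p L₀) = i`. -/
def gensOfLabel (i : ℕ) : Set (GammaTau k K hp0) :=
  {γ | ∃ L, IsNeighbor (unif hp) (stdLat k K hp) L ∧
    latticeLabel (unif hp) (stdLat k K hp) L = i ∧ IsGamma Φ L γ}

/-- The set `Γ \ X₀` of orbits of a subgroup `Γ` of `Γ(τ)` on the vertices of the building. -/
abbrev QuotVert (Γ : Subgroup (GammaTau k K hp0)) : Type _ :=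
  MulAction.orbitRel.Quotient ((Γ.map (GammaTau k K hp0).subtype).map (gammaAct Φ)) (Vert k K hp)

/-- The orbit map `X₀ → Γ \ X₀`. -/
def orbitMap (Γ : Subgroup (GammaTau k K hp0)) (x : Vert k K hp) : QuotVert Φ Γ :=
  Quotient.mk _ x

lemma orbitMap_eq_iff (Γ : Subgroup (GammaTau k K hp0)) (x y : Vert k K hp) :
    orbitMap Φ Γ x = orbitMap Φ Γ y ↔ ∃ γ ∈ Γ, gammaAct Φ γ y = x := by
  refine Quotient.eq.trans ?_
  rw [MulAction.orbitRel_apply, MulAction.mem_orbit_iff]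
  constructor
  · rintro ⟨⟨_, _, ⟨γ, hγ, rfl⟩, rfl⟩, h⟩
    exact ⟨γ, hγ, h⟩
  · rintro ⟨γ, hγ, h⟩
    exact ⟨⟨_, _, ⟨γ, hγ, rfl⟩, rfl⟩, h⟩

end Arithmetic

end

end SkewBuilding

open SkewBuilding

/-! Everything rests on one fact: `Γ(τ)` acts simply transitively on the vertices of the building.
Left translation in the Cayley graph then becomes the action on the building, so edges and labels
need only be compared at `⟨L₀⟩`, where the generators `γ_L` match the neighbors `⟨L⟩`
(`mem_gens_iff`, `mem_gensOfLabel_iff`). Simplices agree because the building is a flag complex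
(`IsUniformizer.mem_faces_iff`), and the statements about quotients follow by taking images under
the orbit map.

Transitivity (`exists_isGamma`, `exists_gammaAct_eq`): the Frobenius of `K` is bijective, so `K{τ}`
has a division algorithm that makes its right ideals principal. If `p ^ n L₀ ⊆ L ⊆ L₀`, the elements
mapping `L₀` into `L` form a right ideal containing `p ^ n`. As `K{τ}` is dense in `O ⊗ K{τ}`, a
generator `f` maps `L₀` onto `L` (`exists_skew_generator`). It divides `p ^ n`, so it is a unit once
`p` is inverted, and `f(0) ≠ 0` because `p(0) ≠ 0`. Multiplying on the right by the constant
`f(0)⁻¹`, which is invertible over `O`, gives an element of `Γ(τ)` with the same effect on `L₀`.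

Freeness (`eq_one_of_gammaAct_eq`): an element fixing `⟨L₀⟩` fixes `L₀` after multiplication by a
power of `p`. It and its inverse are then integral at `p`, hence lie in `K{τ}`, whose units are
constants. The condition at `τ = 0` puts the constant in `kˣ`, so the class is trivial.

Existence of `Φ` (`nonempty_splitting`): let `K` act on `O ⊗ K` by multiplication and `τ` by `y ↦ u
σ(y)`, with `σ` the Frobenius. Then `τ ^ d` acts as the norm of `u`, which must be `t`. That `t` is
a norm is shown modulo `p` by surjectivity of norms between finite fields, then lifted by Hensel's
lemma (`exists_prod_galBaseChange_eq`). -/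

namespace SkewBuilding

noncomputable section

/-! ### Arithmetic of `K{τ}`: degree, division, structure over `k[t]` -/

namespace SkewPoly

section Frobenius

variable (k : Type*) {K : Type*} [Field k] [Fintype k] [Field K] [Algebra k K]

lemma add_pow_card_pow (i : ℕ) (x y : K) :
    (x + y) ^ Fintype.card k ^ i = x ^ Fintype.card k ^ i + y ^ Fintype.card k ^ i := by
  induction i generalizing x y with
  | zero => simp
  | succ i ih =>
    have h : ∀ z : K, z ^ Fintype.card k = FiniteField.frobeniusAlgHom k K z := fun z => by
      simp [FiniteField.frobeniusAlgHom_apply]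
    rw [pow_succ', pow_mul, pow_mul, pow_mul, h, h, h, map_add, ih]

lemma exists_pow_card_pow_eq [Finite K] (i : ℕ) (x : K) : ∃ y : K, y ^ Fintype.card k ^ i = x := by
  have h : Function.Bijective (FiniteField.frobeniusAlgHom k K) :=
    Finite.injective_iff_bijective.mp (FiniteField.frobeniusAlgHom k K).injective
  induction i generalizing x with
  | zero => exact ⟨x, by simp⟩
  | succ i ih =>
    obtain ⟨y, hy⟩ := ih x
    obtain ⟨z, hz⟩ := h.2 y
    refine ⟨z, ?_⟩
    rw [pow_succ', pow_mul, ← hy, ← hz]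
    simp [FiniteField.frobeniusAlgHom_apply]

end Frobenius

variable {k K : Type*} [Field k] [Fintype k] [Field K] [Algebra k K]

/-- The coefficients of a skew polynomial. -/
def coeff (f : SkewPoly k K) (n : ℕ) : K := SkewPolynomial.coeff (R := K) f n

@[simp] lemma coeff_zero (n : ℕ) : coeff (0 : SkewPoly k K) n = 0 := rfl

@[simp] lemma coeff_add (f g : SkewPoly k K) (n : ℕ) :
    coeff (f + g) n = coeff f n + coeff g n :=
  SkewPolynomial.coeff_add (R := K) f g n

lemma coeff_sub (f g : SkewPoly k K) (n : ℕ) : coeff (f - g) n = coeff f n - coeff g n := by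
  rw [eq_sub_iff_add_eq, ← coeff_add, sub_add_cancel]

lemma coeff_term (a : K) (m n : ℕ) :
    coeff (C k K a * τ k K ^ m) n = if m = n then a else 0 := by
  let := frobeniusAction k K
  rw [← SkewPolynomial.coeff_monomial, ← SkewPolynomial.C_mul_X_pow_eq_monomial]
  rfl

lemma coeff_C (a : K) (n : ℕ) : coeff (C k K a) n = if 0 = n then a else 0 := by
  simpa using coeff_term (k := k) a 0 n

lemma coeff_one (n : ℕ) : coeff (1 : SkewPoly k K) n = if 0 = n then 1 else 0 := by
  rw [← map_one (C k K), coeff_C]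

lemma ext_coeff {f g : SkewPoly k K} (h : ∀ n, coeff f n = coeff g n) : f = g :=
  SkewPolynomial.ext (R := K) h

lemma exists_coeff_eq_zero (f : SkewPoly k K) : ∃ N, ∀ n, N ≤ n → coeff f n = 0 := by
  induction f using induction_on with
  | zero => exact ⟨0, fun _ _ => rfl⟩
  | add f g hf hg =>
    obtain ⟨N, hN⟩ := hf
    obtain ⟨M, hM⟩ := hg
    exact ⟨max N M, fun n hn => by
      rw [coeff_add, hN n (le_of_max_le_left hn), hM n (le_of_max_le_right hn), add_zero]⟩
  | term a m => exact ⟨m + 1, fun n hn => by rw [coeff_term, if_neg (by omega)]⟩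

/-- Both sides are biadditive, the right one because `x ↦ x ^ q ^ i` is additive. This leaves the
monomials, where `a τ ^ m * b τ ^ l = a b ^ (q ^ m) τ ^ (m + l)`. -/
lemma coeff_mul (f g : SkewPoly k K) (N : ℕ) : coeff (f * g) N =
    ∑ x ∈ Finset.HasAntidiagonal.antidiagonal N,
      coeff f x.1 * coeff g x.2 ^ Fintype.card k ^ x.1 := by
  have hq : ∀ i, Fintype.card k ^ i ≠ 0 := fun i => pow_ne_zero _ Fintype.card_ne_zero
  induction f using induction_on with
  | zero => simp
  | add f₁ f₂ h₁ h₂ =>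
    rw [add_mul, coeff_add, h₁, h₂, ← Finset.sum_add_distrib]
    exact Finset.sum_congr rfl fun x _ => by rw [coeff_add, add_mul]
  | term a m =>
    induction g using induction_on with
    | zero => simp
    | add g₁ g₂ h₁ h₂ =>
      rw [mul_add, coeff_add, h₁, h₂, ← Finset.sum_add_distrib]
      exact Finset.sum_congr rfl fun x _ => by rw [coeff_add, add_pow_card_pow, mul_add]
    | term b l =>
      have h : C k K a * τ k K ^ m * (C k K b * τ k K ^ l)
          = C k K (a * b ^ Fintype.card k ^ m) * τ k K ^ (m + l) := by
        rw [mul_assoc, ← mul_assoc (τ k K ^ m), τ_pow_mul_C, map_mul, pow_add]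
        simp only [mul_assoc]
      rw [h, coeff_term]
      split_ifs with hN
      · rw [Finset.sum_eq_single (m, l)]
        · simp [coeff_term]
        · rintro ⟨i, j⟩ hij hne
          rw [Finset.HasAntidiagonal.mem_antidiagonal] at hij
          have : m ≠ i := by
            rintro rfl
            exact hne (by ext <;> (simp_all; try omega))
          rw [coeff_term, if_neg this, zero_mul]
        · intro hn
          exact absurd (Finset.HasAntidiagonal.mem_antidiagonal.mpr hN) hn
      · refine (Finset.sum_eq_zero ?_).symm
        rintro ⟨i, j⟩ hij
        rw [Finset.HasAntidiagonal.mem_antidiagonal] at hij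
        rw [coeff_term, coeff_term]
        by_cases hi : m = i
        · rw [if_neg (by dsimp only at hij ⊢; omega : ¬ l = j), zero_pow (hq _), mul_zero]
        · rw [if_neg hi, zero_mul]

/-- The skew polynomial `f` has degree `n`. -/
def HasDegree (f : SkewPoly k K) (n : ℕ) : Prop := coeff f n ≠ 0 ∧ ∀ m, n < m → coeff f m = 0

lemma exists_hasDegree {f : SkewPoly k K} (hf : f ≠ 0) : ∃ n, HasDegree f n := by
  classical
  obtain ⟨N, hN⟩ := exists_coeff_eq_zero f
  have h : ∃ n, ∀ m, n ≤ m → coeff f m = 0 := ⟨N, hN⟩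
  have h0 : Nat.find h ≠ 0 := fun h0 => hf (ext_coeff fun n =>
    Nat.find_spec h n (by rw [h0]; exact Nat.zero_le _))
  obtain ⟨n, hn⟩ := Nat.exists_eq_succ_of_ne_zero h0
  refine ⟨n, fun hc => Nat.find_min h (m := n) (by omega) fun m hm => ?_, fun m hm =>
    Nat.find_spec h m (by omega)⟩
  rcases hm.eq_or_lt with rfl | hm
  · exact hc
  · exact Nat.find_spec h m (by omega)

lemma HasDegree.ne_zero {f : SkewPoly k K} {n : ℕ} (h : HasDegree f n) : f ≠ 0 := by
  rintro rfl
  exact h.1 rfl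

lemma HasDegree.unique {f : SkewPoly k K} {n m : ℕ} (hn : HasDegree f n) (hm : HasDegree f m) :
    n = m := by
  rcases lt_trichotomy n m with h | h | h
  · exact absurd (hn.2 m h) hm.1
  · exact h
  · exact absurd (hm.2 n h) hn.1

/-- Mere bounds on the degrees are assumed so that division can apply this to a quotient term `b τ ^
l` without checking `b ≠ 0`. -/
lemma coeff_mul_of_degree_le {f g : SkewPoly k K} {n m : ℕ} (hf : ∀ i, n < i → coeff f i = 0)
    (hg : ∀ j, m < j → coeff g j = 0) :
    coeff (f * g) (n + m) = coeff f n * coeff g m ^ Fintype.card k ^ n ∧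
      ∀ N, n + m < N → coeff (f * g) N = 0 := by
  have hq : ∀ i, Fintype.card k ^ i ≠ 0 := fun i => pow_ne_zero _ Fintype.card_ne_zero
  constructor
  · rw [coeff_mul, Finset.sum_eq_single (n, m)]
    · rintro ⟨i, j⟩ hij hne
      rw [Finset.HasAntidiagonal.mem_antidiagonal] at hij
      dsimp only at hij ⊢
      by_cases hi : n < i
      · rw [hf i hi, zero_mul]
      · have : m < j := by
          rcases Nat.lt_or_ge m j with h | h
          · exact h
          · exact absurd (Prod.ext (by dsimp only; omega) (by dsimp only; omega)) hne
        rw [hg j this, zero_pow (hq _), mul_zero]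
    · intro h
      exact absurd (by simp) h
  · intro N hN
    rw [coeff_mul]
    refine Finset.sum_eq_zero ?_
    rintro ⟨i, j⟩ hij
    rw [Finset.HasAntidiagonal.mem_antidiagonal] at hij
    dsimp only at hij ⊢
    by_cases hi : n < i
    · rw [hf i hi, zero_mul]
    · rw [hg j (by omega), zero_pow (hq _), mul_zero]

lemma HasDegree.mul {f g : SkewPoly k K} {n m : ℕ} (hf : HasDegree f n) (hg : HasDegree g m) :
    HasDegree (f * g) (n + m) := by
  obtain ⟨h₁, h₂⟩ := coeff_mul_of_degree_le hf.2 hg.2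
  exact ⟨h₁ ▸ mul_ne_zero hf.1 (pow_ne_zero _ hg.1), h₂⟩

instance : NoZeroDivisors (SkewPoly k K) where
  eq_zero_or_eq_zero_of_mul_eq_zero {f g} h := by
    by_contra! hc
    obtain ⟨n, hn⟩ := exists_hasDegree hc.1
    obtain ⟨m, hm⟩ := exists_hasDegree hc.2
    exact (hn.mul hm).ne_zero h

instance : Nontrivial (SkewPoly k K) :=
  ⟨0, 1, fun h => by simpa [coeff_one] using congrArg (coeff · 0) h⟩

instance : IsDomain (SkewPoly k K) := NoZeroDivisors.to_isDomain _

/-- The units of `K{τ}` are the nonzero constants. -/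
lemma eq_C_of_mul_eq_one {f g : SkewPoly k K} (h : f * g = 1) : ∃ a : K, f = C k K a := by
  have hf : f ≠ 0 := left_ne_zero_of_mul_eq_one h
  have hg : g ≠ 0 := right_ne_zero_of_mul_eq_one h
  obtain ⟨n, hn⟩ := exists_hasDegree hf
  obtain ⟨m, hm⟩ := exists_hasDegree hg
  have h1 : HasDegree (1 : SkewPoly k K) 0 :=
    ⟨by simp [coeff_one], fun m hm => by rw [coeff_one, if_neg (by omega)]⟩
  have := (h ▸ hn.mul hm).unique h1
  refine ⟨coeff f 0, ext_coeff fun i => ?_⟩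
  rw [coeff_C]
  split_ifs with hi
  · rw [hi]
  · exact hn.2 i (by omega)

/-- The right ideals of `K{τ}` are principal. -/
lemma exists_eq_mul_of_rightIdeal [Finite K] (I : AddSubgroup (SkewPoly k K))
    (hI : ∀ f ∈ I, ∀ g, f * g ∈ I) : ∃ f ∈ I, ∀ h ∈ I, ∃ g, h = f * g := by
  classical
  by_cases h0 : ∀ f ∈ I, f = 0
  · exact ⟨0, I.zero_mem, fun h hh => ⟨0, by rw [h0 h hh, mul_zero]⟩⟩
  push Not at h0
  have hex : ∃ n, ∃ f ∈ I, HasDegree f n := by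
    obtain ⟨f, hf, hf0⟩ := h0
    obtain ⟨n, hn⟩ := exists_hasDegree hf0
    exact ⟨n, f, hf, hn⟩
  obtain ⟨f, hf, hdeg⟩ := Nat.find_spec hex
  set n := Nat.find hex with hn
  refine ⟨f, hf, ?_⟩
  -- Division algorithm, by induction on a bound for the degree of the dividend; `f` has the least
  -- degree among nonzero elements of `I`.
  suffices H : ∀ N, ∀ h ∈ I, (∀ m, N ≤ m → coeff h m = 0) → ∃ g, h = f * g by
    intro h hh
    obtain ⟨N, hN⟩ := exists_coeff_eq_zero h
    exact H N h hh hN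
  intro N
  induction N with
  | zero =>
    intro h _ hN
    exact ⟨0, by rw [mul_zero]; exact ext_coeff fun m => hN m (Nat.zero_le _)⟩
  | succ N ih =>
    intro h hh hN
    by_cases hc : coeff h N = 0
    · refine ih h hh fun m hm => ?_
      rcases hm.eq_or_lt with rfl | hm
      · exact hc
      · exact hN m hm
    have hnN : n ≤ N := Nat.find_min' hex ⟨h, hh, hc, fun m hm => hN m hm⟩
    obtain ⟨l, rfl⟩ := Nat.exists_eq_add_of_le hnN
    -- The leading coefficient of `f * b τ ^ l` is that of `f` times `b ^ (q ^ n)`, so cancelling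
    -- the leading term of `h` requires a `q ^ n`-th root in `K`.
    obtain ⟨b, hb⟩ := exists_pow_card_pow_eq k n ((coeff f n)⁻¹ * coeff h (n + l))
    obtain ⟨h₁, h₂⟩ := coeff_mul_of_degree_le (f := f) (g := C k K b * τ k K ^ l) (n := n) (m := l)
      hdeg.2 fun j hj => by rw [coeff_term, if_neg (by omega)]
    rw [coeff_term, if_pos rfl, hb, mul_inv_cancel_left₀ hdeg.1] at h₁
    obtain ⟨g, hg⟩ := ih (h - f * (C k K b * τ k K ^ l)) (I.sub_mem hh (hI _ hf _)) fun m hm => by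
      rw [coeff_sub]
      rcases hm.eq_or_lt with rfl | hm
      · rw [h₁, sub_self]
      · rw [h₂ m hm, hN m hm, sub_zero]
    exact ⟨g + C k K b * τ k K ^ l, by rw [mul_add, ← hg, sub_add_cancel]⟩

section Module

variable [FiniteDimensional k K]

/-- The coefficients of `g` can be read off from `g(τ ^ d)` in the degrees divisible by `d > 0`. -/
lemma algebraMap_injective : Function.Injective (algebraMap k[X] (SkewPoly k K)) := by
  have hd : 0 < Module.finrank k K := Module.finrank_pos
  have key : ∀ (g : k[X]) (n : ℕ),
      coeff (algebraMap k[X] (SkewPoly k K) g) (Module.finrank k K * n)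
        = algebraMap k K (g.coeff n) := by
    intro g n
    induction g using Polynomial.induction_on' with
    | add g h hg hh => rw [map_add, coeff_add, hg, hh, Polynomial.coeff_add, map_add]
    | monomial m c =>
      rw [← C_mul_X_pow_eq_monomial, map_mul, map_pow, algebraMap_C, algebraMap_X, ← pow_mul,
        coeff_term, Polynomial.coeff_C_mul, Polynomial.coeff_X_pow]
      by_cases h : m = n
      · simp [h]
      · rw [if_neg (by simpa [hd.ne'] using h), if_neg (Ne.symm h), mul_zero, map_zero]
  intro g h hgh
  ext n
  have := key g n
  rw [hgh, key h n] at this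
  exact ((algebraMap k K).injective this).symm

instance : Module.IsTorsionFree k[X] (SkewPoly k K) := by
  refine .of_smul_eq_zero fun g f h => ?_
  rw [Algebra.smul_def, mul_eq_zero] at h
  exact h.imp_left fun h => algebraMap_injective (h.trans (map_zero _).symm)

/-- Division of an exponent by `d` moves the multiples of `d` into powers of the scalar `t`. The
number of generators, `d ^ 2`, is the rank of the matrix algebra; `injective_of_surjective_matrix`
exploits this. -/
lemma span_C_mul_τ_pow (b : Module.Basis (Fin (Module.finrank k K)) k K) :
    Submodule.span k[X] (Set.range fun x : Fin (Module.finrank k K) × Fin (Module.finrank k K) =>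
      C k K (b x.1) * τ k K ^ (x.2 : ℕ)) = (⊤ : Submodule k[X] (SkewPoly k K)) := by
  rw [eq_top_iff]
  rintro f -
  have hd : 0 < Module.finrank k K := Module.finrank_pos
  induction f using induction_on with
  | zero => exact Submodule.zero_mem _
  | add f g hf hg => exact Submodule.add_mem _ hf hg
  | term a m =>
    have ha : C k K a * τ k K ^ m = ∑ i, (Polynomial.C (b.repr a i) * X ^ (m / Module.finrank k K))
        • (C k K (b i) * τ k K ^ (m % Module.finrank k K)) := by
      conv_lhs => rw [← b.sum_repr a, map_sum, Finset.sum_mul]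
      refine Finset.sum_congr rfl fun i _ => ?_
      rw [Algebra.smul_def, map_mul, Algebra.smul_def, map_mul, map_pow, algebraMap_C,
        algebraMap_X, ← pow_mul]
      have hc : Commute (C k K (b i))
          (τ k K ^ (Module.finrank k K * (m / Module.finrank k K))) := by
        rw [pow_mul]
        exact ((τ_pow_finrank_commute k K _).pow_left _).symm
      conv_lhs => rw [← Nat.div_add_mod m (Module.finrank k K), pow_add]
      rw [mul_assoc (C k K _), ← mul_assoc (C k K (b i)), hc.eq]
      simp only [mul_assoc]
    rw [ha]
    exact Submodule.sum_mem _ fun i _ => Submodule.smul_mem _ _ (Submodule.subset_span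
      ⟨(i, ⟨m % Module.finrank k K, Nat.mod_lt _ hd⟩), rfl⟩)

instance : Module.Finite k[X] (SkewPoly k K) :=
  ⟨⟨(Set.finite_range _).toFinset, by
    rw [Set.Finite.coe_toFinset]
    exact span_C_mul_τ_pow (Module.finBasis k K)⟩⟩

instance : Module.Free k[X] (SkewPoly k K) := Module.free_of_finite_type_torsion_free'

end Module

end SkewPoly

/-! ### The completion at `p`: approximation, uniformizer, Hensel property -/

section Local

open WithZero

variable {k : Type*} [Field k] {p : k[X]} (hp : Irreducible p)

lemma valued_algebraMap_p :
    Valued.v (algebraMap k[X] (LocalField hp) p) = exp (-1 : ℤ) := by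
  rw [IsScalarTower.algebraMap_apply k[X] (RatFunc k) (LocalField hp)]
  refine (HeightOneSpectrum.valuedAdicCompletion_eq_valuation' (place hp) _).trans ?_
  rw [Algebra.algebraMap_self_apply]
  refine (HeightOneSpectrum.valuation_of_algebraMap (place hp) p).trans ?_
  exact HeightOneSpectrum.intValuation_singleton (place hp) hp.ne_zero rfl

lemma valued_algebraMap_p_pow (n : ℕ) :
    Valued.v (algebraMap k[X] (LocalField hp) p ^ n) = exp (-n : ℤ) := by
  rw [map_pow, valued_algebraMap_p, ← exp_nsmul]
  simp

lemma algebraMap_localRing_coe (a : k[X]) :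
    ((algebraMap k[X] (LocalRing hp) a : LocalRing hp) : LocalField hp)
      = algebraMap k[X] (LocalField hp) a := rfl

lemma p_pow_dvd_iff (x : LocalRing hp) (n : ℕ) :
    algebraMap k[X] (LocalRing hp) p ^ n ∣ x ↔ Valued.v (x : LocalField hp) ≤ exp (-n : ℤ) := by
  rw [(HeightOneSpectrum.adicCompletionIntegers.integers (RatFunc k) (place hp)).dvd_iff_le,
    map_pow, ← valued_algebraMap_p_pow hp n]
  rfl

lemma p_pow_dvd_of_dvd (a : k[X]) (n : ℕ)
    (h : algebraMap k[X] (LocalRing hp) p ^ n ∣ algebraMap k[X] (LocalRing hp) a) : p ^ n ∣ a := by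
  rw [p_pow_dvd_iff, algebraMap_localRing_coe,
    IsScalarTower.algebraMap_apply k[X] (RatFunc k) (LocalField hp)] at h
  replace h := (HeightOneSpectrum.valuedAdicCompletion_eq_valuation' (place hp) _).symm.trans_le h
  rw [Algebra.algebraMap_self_apply] at h
  replace h := (HeightOneSpectrum.valuation_of_algebraMap (place hp) a).symm.trans_le h
  rw [HeightOneSpectrum.intValuation_le_pow_iff_mem] at h
  change a ∈ Ideal.span {p} ^ n at h
  rwa [Ideal.span_singleton_pow, Ideal.mem_span_singleton] at h

/-- Two approximations are combined: `x` by some `z ∈ k(t)`, by density, and then `z`, which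
inherits integrality at `p` from `x`, by a polynomial. -/
lemma exists_sub_mem_p_pow (x : LocalRing hp) (n : ℕ) :
    ∃ (a : k[X]) (y : LocalRing hp),
      x = algebraMap k[X] (LocalRing hp) a + algebraMap k[X] (LocalRing hp) p ^ n * y := by
  have hd := HeightOneSpectrum.denseRange_algebraMap (K := RatFunc k) (v := place hp)
  have hc : (Valued.v : Valuation (LocalField hp) _).restrict
      (algebraMap k[X] (LocalField hp) p ^ n) ≠ 0 := by
    rw [ne_eq, Valuation.restrict_eq_zero_iff, Valuation.zero_iff]
    exact pow_ne_zero _ (algebraMap_local_ne_zero hp)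
  obtain ⟨z, hz⟩ := hd.exists_mem_open (s := {z | (Valued.v : Valuation (LocalField hp) _).restrict
      (z - x) < (Valued.v : Valuation (LocalField hp) _).restrict
      (algebraMap k[X] (LocalField hp) p ^ n)})
    ((Valued.isOpen_ball (LocalField hp) _).preimage (continuous_id.sub continuous_const))
    ⟨x, by simpa [zero_lt_iff] using hc⟩
  rw [Set.mem_ofPred_eq, Valuation.restrict_lt_iff, valued_algebraMap_p_pow] at hz
  have hz1 : (place hp).valuation (RatFunc k) z ≤ 1 := by
    rw [← HeightOneSpectrum.valuedAdicCompletion_eq_valuation' (place hp) z]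
    have : algebraMap (RatFunc k) (LocalField hp) z
        = (algebraMap (RatFunc k) (LocalField hp) z - x) + x := by ring
    change Valued.v (algebraMap (RatFunc k) (LocalField hp) z) ≤ 1
    rw [this]
    refine (Valuation.map_add _ _ _).trans (max_le (hz.le.trans ?_) x.2)
    rw [← exp_zero, exp_le_exp]
    omega
  obtain ⟨a, ha⟩ := HeightOneSpectrum.exists_valuation_sub_lt_of_integer (place hp) hz1
    (Units.mk0 (exp (-n : ℤ)) exp_ne_zero)
  rw [← HeightOneSpectrum.valuedAdicCompletion_eq_valuation' (place hp)] at ha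
  change Valued.v
    (algebraMap (RatFunc k) (LocalField hp) (algebraMap k[X] (RatFunc k) a - z)) < _ at ha
  rw [map_sub, ← IsScalarTower.algebraMap_apply, Units.val_mk0] at ha
  have h : algebraMap k[X] (LocalRing hp) p ^ n ∣ x - algebraMap k[X] (LocalRing hp) a := by
    rw [p_pow_dvd_iff]
    change Valued.v ((x : LocalField hp) - algebraMap k[X] (LocalField hp) a) ≤ _
    rw [Valuation.map_sub_swap]
    have : algebraMap k[X] (LocalField hp) a - (x : LocalField hp)
      = (algebraMap k[X] (LocalField hp) a - algebraMap (RatFunc k) (LocalField hp) z) +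
        (algebraMap (RatFunc k) (LocalField hp) z - x) := by ring
    rw [this]
    exact (Valuation.map_add _ _ _).trans (max_le ha.le hz.le)
  obtain ⟨y, hy⟩ := h
  exact ⟨a, y, by rw [← hy]; ring⟩

lemma exists_p_zpow_mul_unit (c : (LocalField hp)ˣ) : ∃ (j : ℤ) (u : (LocalRing hp)ˣ),
    (c : LocalField hp) = (unif hp : LocalField hp) ^ j * ((u : LocalRing hp) : LocalField hp) := by
  have hv : Valued.v (c : LocalField hp) ≠ 0 := by simp
  obtain ⟨j, hj⟩ : ∃ j : ℤ, Valued.v (c : LocalField hp) = exp (-j) :=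
    ⟨-log (Valued.v (c : LocalField hp)), by rw [neg_neg, exp_log hv]⟩
  have hpz : Valued.v ((unif hp : LocalField hp) ^ j) = exp (-j) := by
    rw [map_zpow₀]
    change Valued.v (algebraMap k[X] (LocalField hp) p) ^ j = _
    rw [valued_algebraMap_p, ← exp_zsmul]
    simp
  have hone : Valued.v ((unif hp : LocalField hp) ^ (-j) * c) = 1 := by
    rw [map_mul, zpow_neg, map_inv₀, hpz, hj, inv_mul_cancel₀ exp_ne_zero]
  have hu : IsUnit (⟨(unif hp : LocalField hp) ^ (-j) * c, hone.le⟩ : LocalRing hp) :=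
    HeightOneSpectrum.adicCompletionIntegers.isUnit_iff_valued_eq_one.mpr hone
  refine ⟨j, hu.unit, ?_⟩
  rw [IsUnit.unit_spec]
  change (c : LocalField hp)
    = (unif hp : LocalField hp) ^ j * ((unif hp : LocalField hp) ^ (-j) * c)
  rw [← mul_assoc, ← zpow_add₀ (Units.ne_zero _), add_neg_cancel, zpow_zero, one_mul]

instance : IsTopologicalRing (LocalRing hp) :=
  inferInstanceAs (IsTopologicalRing ((place hp).adicCompletionIntegers (RatFunc k)).toSubring)

/-- This identifies the valuation topology with the `p`-adic one, so that completeness of the field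
yields adic completeness of `O`, and with it Hensel's lemma. -/
lemma isAdic_span_p : IsAdic (Ideal.span {algebraMap k[X] (LocalRing hp) p}) := by
  have hmem : ∀ (n : ℕ) (x : LocalRing hp), x ∈ Ideal.span {algebraMap k[X] (LocalRing hp) p} ^ n ↔
      (Valued.v : Valuation (LocalField hp) _).restrict x ≤
        (Valued.v : Valuation (LocalField hp) _).restrict (algebraMap k[X] (LocalField hp) p ^ n) :=
    fun n x => by
      rw [Ideal.span_singleton_pow, Ideal.mem_span_singleton, p_pow_dvd_iff,
        Valuation.restrict_le_iff, valued_algebraMap_p_pow]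
  rw [isAdic_iff]
  constructor
  · intro n
    have hc : (Valued.v : Valuation (LocalField hp) _).restrict
        (algebraMap k[X] (LocalField hp) p ^ n) ≠ 0 := by
      rw [ne_eq, Valuation.restrict_eq_zero_iff, Valuation.zero_iff]
      exact pow_ne_zero _ (algebraMap_local_ne_zero hp)
    have := (Valued.isOpen_closedBall (LocalField hp) hc).preimage
      (continuous_subtype_val (p := fun x => x ∈ (place hp).adicCompletionIntegers (RatFunc k)))
    convert! this using 1
    ext x
    exact hmem n x
  · intro s hs
    rw [nhds_subtype, Filter.mem_comap] at hs
    obtain ⟨t, ht, hts⟩ := hs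
    obtain ⟨γ, hγ⟩ := Valued.mem_nhds_zero.mp ht
    have hne : MonoidWithZeroHom.ValueGroup₀.embedding γ.1 ≠ 0 := by simp
    -- Members of the `n`-th power of the ideal satisfy a non-strict bound `exp (-n)`, while the
    -- ball is strict; the summand `1` makes up for this.
    refine ⟨(1 - log (MonoidWithZeroHom.ValueGroup₀.embedding γ.1)).toNat,
      fun x hx => hts (hγ ?_)⟩
    rw [SetLike.mem_coe, Ideal.span_singleton_pow, Ideal.mem_span_singleton, p_pow_dvd_iff] at hx
    rw [Set.mem_ofPred_eq, Valuation.restrict_lt_iff_lt_embedding]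
    refine hx.trans_lt ?_
    rw [← lt_log_iff_exp_lt hne]
    omega

instance : IsAdicComplete (Ideal.span {algebraMap k[X] (LocalRing hp) p}) (LocalRing hp) := by
  have hc : CompleteSpace (LocalRing hp) :=
    (Valued.isClosed_valuationSubring (LocalField hp)).completeSpace_coe
  have : IsUniformAddGroup (LocalRing hp) :=
    inferInstanceAs (
      IsUniformAddGroup ((place hp).adicCompletionIntegers (RatFunc k)).toSubring.toAddSubgroup)
  exact (isAdic_span_p hp).isAdicComplete_iff.mpr ⟨hc, inferInstance⟩

/-- The image of `t` in the completion at `p` is a unit if `p (0) ≠ 0`. -/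
lemma isUnit_algebraMap_X (hp0 : p.eval 0 ≠ 0) :
    IsUnit (algebraMap k[X] (LocalRing hp) X) := by
  obtain ⟨q, hq⟩ : X ∣ p - C (p.eval 0) := by
    rw [X_dvd_iff, Polynomial.coeff_sub, Polynomial.coeff_C_zero,
      Polynomial.coeff_zero_eq_eval_zero, sub_self]
  have hjac := HenselianRing.jac (R := LocalRing hp)
    (I := Ideal.span {algebraMap k[X] (LocalRing hp) p})
  have h1 := Ideal.mem_jacobson_bot.mp (hjac (Ideal.mem_span_singleton_self _))
    (algebraMap k[X] (LocalRing hp) (C (-(p.eval 0)⁻¹)))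
  have h2 : IsUnit (algebraMap k[X] (LocalRing hp) (C (-p.eval 0))) :=
    ((isUnit_iff_ne_zero.mpr (neg_ne_zero.mpr hp0)).map C).map _
  -- With `X q = p - p(0)`, this is `X q = -p(0) (1 - p / p(0))`; the last factor is a unit because
  -- `p` lies in the Jacobson radical.
  have h3 : algebraMap k[X] (LocalRing hp) X * algebraMap k[X] (LocalRing hp) q
      = algebraMap k[X] (LocalRing hp) (C (-p.eval 0)) *
        (algebraMap k[X] (LocalRing hp) p *
          algebraMap k[X] (LocalRing hp) (C (-(p.eval 0)⁻¹)) + 1) := by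
    rw [← map_mul, ← map_mul, ← map_one (algebraMap k[X] (LocalRing hp)), ← map_add, ← map_mul,
      ← hq]
    congr 1
    have h4 : C (p.eval 0) * C ((p.eval 0)⁻¹) = 1 := by
      rw [← C_mul, mul_inv_cancel₀ hp0, C_1]
    rw [C_neg, C_neg]
    linear_combination -p * h4
  exact isUnit_of_mul_isUnit_left (h3 ▸ h2.mul h1)

end Local

/-! ### Norms modulo an irreducible polynomial -/

section ResidueNorm

/-- In a finite field with a faithful action of a finite group, every fixed element is a norm. -/
lemma exists_prod_smul_eq (H E : Type*) [Group H] [Fintype H] [Field E] [Finite E]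
    [MulSemiringAction H E] [FaithfulSMul H E] (x : E) (hx : ∀ s : H, s • x = x) :
    ∃ e : E, ∏ s : H, s • e = x := by
  classical
  obtain ⟨e, he⟩ := FiniteField.norm_surjective (FixedPoints.subfield H E) E ⟨x, hx⟩
  refine ⟨e, ?_⟩
  have h := Algebra.norm_eq_prod_automorphisms (FixedPoints.subfield H E) e
  rw [he] at h
  refine Eq.trans ?_ h.symm
  exact Fintype.prod_equiv (FixedPoints.toAlgAutMulEquiv H E).toEquiv _ _ fun s => rfl

variable {k K : Type*} [Field k] [Finite k] [Field K] [Algebra k K] [FiniteDimensional k K]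

lemma isGalois_of_finite : IsGalois k K := by
  have : Finite K := Module.finite_of_finite k
  infer_instance

lemma exists_map_eq_of_smul_eq (f : K[X]) (hf : ∀ s : K ≃ₐ[k] K, s • f = f) :
    ∃ g : k[X], g.map (algebraMap k K) = f := by
  have := isGalois_of_finite (k := k) (K := K)
  refine (Polynomial.mem_lifts f).mp ((Polynomial.lifts_iff_coeff_lifts f).mpr fun n => ?_)
  rw [IsGalois.mem_range_algebraMap_iff_fixed]
  intro s
  conv_rhs => rw [← hf s]
  rw [Polynomial.coeff_smul]
  rfl

lemma smul_prod_smul {G B : Type*} [Group G] [Fintype G] [CommRing B] [MulSemiringAction G B]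
    (b : B) (s : G) : s • ∏ r : G, r • b = ∏ r : G, r • b := by
  rw [Finset.smul_prod']
  exact Fintype.prod_equiv (Equiv.mulLeft s) _ _ fun r => (mul_smul s r b).symm

open Pointwise in
/-- Let a finite group `G` act on the ring `B`, and let the stabilizer of a maximal ideal with
finite residue field act faithfully on this field. Then every fixed element of `B` is a norm modulo
the maximal ideal. -/
lemma exists_prod_smul_sub_mem {G B A E : Type*} [Group G] [Fintype G] [CommRing B]
    [MulSemiringAction G B] [CommRing A] [Field E] [Algebra A E] [Finite E]
    (M : Ideal B) [hM : M.IsMaximal] (π : B →+* E) (hπ : Function.Surjective π)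
    (hker : ∀ b, π b = 0 ↔ b ∈ M) (φ : MulAction.stabilizer G M →* (E ≃ₐ[A] E))
    (hφ : Function.Injective φ) (hcomp : ∀ s b, φ s (π b) = π ((s : G) • b))
    (x : B) (hx : ∀ s : G, s • x = x) : ∃ h : B, ∏ s : G, s • h - x ∈ M := by
  classical
  let : MulSemiringAction (MulAction.stabilizer G M) E := MulSemiringAction.compHom E φ
  have hfaith : FaithfulSMul (MulAction.stabilizer G M) E :=
    ⟨fun {s r} h => hφ (AlgEquiv.ext h)⟩
  -- First solve the problem in the residue field, for the decomposition group alone.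
  obtain ⟨e, he⟩ := exists_prod_smul_eq (MulAction.stabilizer G M) E (π x)
    fun s => (hcomp s x).trans (congrArg π (hx s))
  obtain ⟨b, rfl⟩ := hπ e
  have hmax : ∀ I : MulAction.orbit G M, (I : Ideal B).IsMaximal := by
    rintro ⟨_, s, rfl⟩
    exact Ideal.map_isMaximal_of_equiv (MulSemiringAction.toRingEquiv G B s)
  have hcop : Pairwise (Function.onFun IsCoprime
      (fun I : MulAction.orbit G M => (I : Ideal B))) := fun I J hIJ => by
    have := hmax I
    have := hmax J
    exact Ideal.isCoprime_of_isMaximal fun h => hIJ (Subtype.ext h)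
  have : Finite (MulAction.orbit G M) := (Set.finite_range fun s : G => s • M).to_subtype
  -- By the Chinese remainder theorem, `h` is the local solution modulo `M` and `1` modulo the other
  -- conjugates of `M`. Hence the factors `s • h` with `s` outside the stabilizer are `1` modulo
  -- `M`.
  obtain ⟨h, hh⟩ := Ideal.exists_forall_sub_mem_ideal hcop
    fun I => if (I : Ideal B) = M then b else 1
  have hfac : ∀ s : G, π (s • h) = if s ∈ MulAction.stabilizer G M then π (s • b) else 1 := by
    intro s
    have h1 := hh ⟨s⁻¹ • M, s⁻¹, rfl⟩
    have hiff : s⁻¹ • M = M ↔ s ∈ MulAction.stabilizer G M := by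
      rw [inv_smul_eq_iff, eq_comm]
      rfl
    rw [Ideal.mem_pointwise_smul_iff_inv_smul_mem, inv_inv, smul_sub, ← hker, map_sub,
      sub_eq_zero] at h1
    rw [h1]
    simp only [hiff]
    split_ifs with hs
    · rfl
    · rw [smul_one, map_one]
  refine ⟨h, ?_⟩
  rw [← hker, map_sub, sub_eq_zero, map_prod, ← he]
  simp only [hfac]
  rw [← Finset.prod_filter]
  exact (Finset.prod_subtype (Finset.univ.filter (· ∈ MulAction.stabilizer G M)) (by simp) _).trans
    (Finset.prod_congr rfl fun s _ => (hcomp s b).symm)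

/-- The polynomial `X` is a norm from `K[X]` modulo an irreducible polynomial over `k`. -/
lemma exists_norm_eq_X_mod {p : k[X]} (hp : Irreducible p) : ∃ (h : K[X]) (r : k[X]),
    ∏ s : K ≃ₐ[k] K, s • h = (X + p * r).map (algebraMap k K) := by
  have : Finite K := Module.finite_of_finite k
  have hpu : ¬ IsUnit (p.map (algebraMap k K)) := fun h =>
    hp.not_isUnit (by rwa [Polynomial.isUnit_map] at h)
  have hp0 : p.map (algebraMap k K) ≠ 0 := by
    simpa [Polynomial.map_eq_zero] using hp.ne_zero
  obtain ⟨M, hM, hpM⟩ := exists_max_ideal_of_mem_nonunits hpu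
  let : Field (K[X] ⧸ M) := Ideal.Quotient.field M
  have hfin : Finite (K[X] ⧸ M) := by
    have hq := (Polynomial.monic_mul_leadingCoeff_inv hp0).finite_quotient
    have hle : Ideal.span {p.map (algebraMap k K) *
        C (p.map (algebraMap k K)).leadingCoeff⁻¹} ≤ M := by
      rw [Ideal.span_singleton_le_iff_mem]
      exact M.mul_mem_right _ hpM
    have : Finite (K[X] ⧸ Ideal.span {p.map (algebraMap k K) *
      C (p.map (algebraMap k K)).leadingCoeff⁻¹}) := Module.finite_of_finite K
    exact Finite.of_surjective _ (Ideal.Quotient.factor_surjective hle)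
  obtain ⟨h, hh⟩ := exists_prod_smul_sub_mem M (Ideal.Quotient.mk M) Ideal.Quotient.mk_surjective
    (fun b => Ideal.Quotient.eq_zero_iff_mem)
    (Ideal.Quotient.stabilizerHom M (M.under ℤ) (K ≃ₐ[k] K))
    -- The stabilizer acts faithfully already on the constants `K`, which embed in the residue
    -- field.
    (fun s r h => by
      apply Subtype.ext
      apply AlgEquiv.ext
      intro a
      have h1 : Ideal.Quotient.mk M ((s : K ≃ₐ[k] K) • C a)
          = Ideal.Quotient.mk M ((r : K ≃ₐ[k] K) • C a) :=
        DFunLike.congr_fun h (Ideal.Quotient.mk M (C a))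
      rw [Polynomial.smul_C, Polynomial.smul_C] at h1
      exact ((Ideal.Quotient.mk M).comp C).injective h1)
    (fun s b => rfl) X fun s => Polynomial.smul_X s
  obtain ⟨g, hg⟩ := exists_map_eq_of_smul_eq (∏ s : K ≃ₐ[k] K, s • h) (smul_prod_smul h)
  -- The congruence is known only modulo one prime `M` of `K[X]` above `p`. Both sides have
  -- coefficients in `k`, so it descends: were `p` and `g - X` coprime over `k`, then `1 ∈ M`.
  have hdvd : p ∣ g - X := by
    by_contra hnd
    obtain ⟨a, c, hac⟩ := (hp.coprime_iff_not_dvd.mpr hnd)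
    apply hM.ne_top
    rw [Ideal.eq_top_iff_one]
    have h1 : (a * p + c * (g - X)).map (algebraMap k K) = 1 := by rw [hac]; simp
    rw [← h1, Polynomial.map_add, Polynomial.map_mul, Polynomial.map_mul, Polynomial.map_sub, hg,
      Polynomial.map_X]
    exact M.add_mem (M.mul_mem_left _ hpM) (M.mul_mem_left _ hh)
  obtain ⟨r, hr⟩ := hdvd
  exact ⟨h, r, by rw [← hr, add_sub_cancel, hg]⟩

end ResidueNorm

/-! ### Lifting norms by Hensel's lemma -/

section HenselNorm

variable {k K : Type*} [Field k] [Field K] [Algebra k K]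

section Action

variable {O : Type*} [CommRing O] [Algebra k O]

variable (O) in
/-- The action of `Gal (K / k)` on `O ⊗ K`. -/
def galBaseChange (s : K ≃ₐ[k] K) : O ⊗[k] K →ₐ[O] O ⊗[k] K :=
  Algebra.TensorProduct.map (AlgHom.id O O) (s : K →ₐ[k] K)

@[simp] lemma galBaseChange_tmul (s : K ≃ₐ[k] K) (x : O) (a : K) :
    galBaseChange O s (x ⊗ₜ[k] a) = x ⊗ₜ[k] s a := rfl

lemma galBaseChange_mul (s r : K ≃ₐ[k] K) :
    galBaseChange O (s * r) = (galBaseChange O s).comp (galBaseChange O r) := by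
  apply Algebra.TensorProduct.ext'
  intro x a
  rfl

@[simp] lemma galBaseChange_one :
    galBaseChange O (1 : K ≃ₐ[k] K) = AlgHom.id O (O ⊗[k] K) := by
  apply Algebra.TensorProduct.ext'
  intro x a
  rfl

end Action

variable [Finite k] [FiniteDimensional k K]

/-- There is a norm polynomial `N (X + w)` over `k` with a simple value at `0`. -/
lemma exists_norm_X_add_C : ∃ (w : K) (Q : k[X]), w ≠ 0 ∧ Q.Monic ∧ 0 < Q.degree ∧
    Q.map (algebraMap k K) = ∏ s : K ≃ₐ[k] K, (X + C (s w)) ∧ Q.derivative.eval 0 ≠ 0 := by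
  classical
  have := isGalois_of_finite (k := k) (K := K)
  -- Take `w = v⁻¹`. The derivative of `N (X + w)` at `0` is `N(w) Tr(w⁻¹)`, so trace `1` for `v`
  -- makes it equal to `N(w) ≠ 0`.
  obtain ⟨v, hv⟩ := Algebra.trace_surjective k K 1
  have hv0 : v ≠ 0 := by
    rintro rfl
    simp at hv
  obtain ⟨Q, hQ⟩ := exists_map_eq_of_smul_eq (∏ s : K ≃ₐ[k] K, s • (X + C v⁻¹ : K[X]))
    (smul_prod_smul _)
  replace hQ : Q.map (algebraMap k K) = ∏ s : K ≃ₐ[k] K, (X + C (s v⁻¹)) := by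
    rw [hQ]
    refine Finset.prod_congr rfl fun s _ => ?_
    rw [smul_add, Polynomial.smul_X, Polynomial.smul_C]
    rfl
  refine ⟨v⁻¹, Q, inv_ne_zero hv0, ?_, ?_, hQ, ?_⟩
  · rw [← Polynomial.monic_map_iff (f := algebraMap k K), hQ]
    exact Polynomial.monic_prod_of_monic _ _ fun s _ => Polynomial.monic_X_add_C _
  · rw [← Polynomial.degree_map Q (algebraMap k K), hQ,
      Polynomial.degree_prod_of_monic _ _ fun s _ => Polynomial.monic_X_add_C _]
    simp only [Polynomial.degree_X_add_C, Finset.sum_const, Finset.card_univ, nsmul_eq_mul, mul_one]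
    exact_mod_cast Fintype.card_pos
  · intro h
    have h1 : (Q.map (algebraMap k K)).derivative.eval 0 = 0 := by
      rw [Polynomial.derivative_map, Polynomial.eval_zero_map, h, map_zero]
    rw [hQ, Polynomial.derivative_prod_finset, Polynomial.eval_finsetSum] at h1
    have h2 : ∀ s : K ≃ₐ[k] K, Polynomial.eval 0 ((∏ r ∈ Finset.univ.erase s, (X + C (r v⁻¹))) *
        derivative (X + C (s v⁻¹))) = (∏ r : K ≃ₐ[k] K, r v⁻¹) * s v := by
      intro s
      rw [← Finset.mul_prod_erase _ _ (Finset.mem_univ s), Polynomial.eval_mul,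
        Polynomial.eval_prod]
      have : s v ≠ 0 := by simpa using hv0
      simp only [map_inv₀, eval_add, eval_X, eval_C, zero_add, derivative_add, derivative_X,
        derivative_C, add_zero, eval_one, mul_one]
      field_simp
    simp only [h2] at h1
    rw [← Finset.mul_sum, ← trace_eq_sum_automorphisms, hv, map_one, mul_one,
      Finset.prod_eq_zero_iff] at h1
    obtain ⟨r, -, hr⟩ := h1
    simp [hv0] at hr

variable {O : Type*} [CommRing O] [Algebra k O] [Algebra k[X] O] [IsScalarTower k k[X] O]

/-- If `O` is Henselian at the image of `p` and the image of `t` in `O` is a unit, then `t` is a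
norm from `O ⊗ K`. -/
lemma exists_prod_galBaseChange_eq {p : k[X]} (hp : Irreducible p)
    [HenselianRing O (Ideal.span {algebraMap k[X] O p})] (ht : IsUnit (algebraMap k[X] O X)) :
    ∃ u : O ⊗[k] K, ∏ s : K ≃ₐ[k] K, galBaseChange O s u
      = algebraMap O (O ⊗[k] K) (algebraMap k[X] O X) := by
  classical
  set t := algebraMap k[X] O X with ht_def
  set π := algebraMap k[X] O p with hπ_def
  let iK : K →+* O ⊗[k] K := (Algebra.TensorProduct.includeRight : K →ₐ[k] O ⊗[k] K).toRingHom
  have hiK : ∀ a : k, iK (algebraMap k K a) = algebraMap O (O ⊗[k] K) (algebraMap k O a) :=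
    fun a => by
      change Algebra.TensorProduct.includeRight (algebraMap k K a) = _
      rw [AlgHom.commutes, ← IsScalarTower.algebraMap_apply]
  have hgal : ∀ (s : K ≃ₐ[k] K) (a : K), galBaseChange O s (iK a) = iK (s a) := fun s a => rfl
  -- Evaluation at an element of `O` is Galois equivariant, so norm identities in `K[X]` specialize
  -- to `O ⊗ K`.
  have hev : ∀ (x : O) (s : K ≃ₐ[k] K) (f : K[X]),
      galBaseChange O s (f.eval₂ iK (algebraMap O _ x)) = (s • f).eval₂ iK (algebraMap O _ x) := by
    intro x s f
    induction f using Polynomial.induction_on' with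
    | add f g hf hg => rw [eval₂_add, map_add, hf, hg, smul_add, eval₂_add]
    | monomial n a =>
      rw [Polynomial.smul_monomial, eval₂_monomial, eval₂_monomial, map_mul, map_pow,
        AlgHom.commutes, hgal]
      rfl
  have hmap : ∀ (x : O) (g : k[X]), (g.map (algebraMap k K)).eval₂ iK (algebraMap O _ x)
      = algebraMap O (O ⊗[k] K) (g.eval₂ (algebraMap k O) x) := by
    intro x g
    rw [eval₂_map, Polynomial.hom_eval₂]
    congr 1
    exact RingHom.ext hiK
  have hk : ∀ g : k[X], g.eval₂ (algebraMap k O) t = algebraMap k[X] O g := by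
    intro g
    induction g using Polynomial.induction_on' with
    | add f g hf hg => rw [eval₂_add, hf, hg, map_add]
    | monomial n a =>
      rw [eval₂_monomial, ← C_mul_X_pow_eq_monomial, map_mul, map_pow,
        IsScalarTower.algebraMap_apply k k[X] O]
      rfl
  obtain ⟨h, r, hr⟩ := exists_norm_eq_X_mod (K := K) hp
  obtain ⟨w, Q, hw, hQm, hQd, hQ, hQ'⟩ := exists_norm_X_add_C (k := k) (K := K)
  set r' := algebraMap k[X] O r
  have hN1 : ∏ s : K ≃ₐ[k] K, galBaseChange O s (h.eval₂ iK (algebraMap O _ t))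
      = algebraMap O (O ⊗[k] K) (t + π * r') := by
    simp only [hev]
    rw [← Polynomial.eval₂_finsetProd, hr, hmap, hk, map_add, map_mul]
  have hN2 : ∀ x : O, ∏ s : K ≃ₐ[k] K, galBaseChange O s (algebraMap O _ x + iK w)
      = algebraMap O (O ⊗[k] K) (Q.eval₂ (algebraMap k O) x) := by
    intro x
    rw [← hmap, hQ, Polynomial.eval₂_finsetProd]
    refine Finset.prod_congr rfl fun s _ => ?_
    rw [map_add, AlgHom.commutes, hgal, eval₂_add, eval₂_X, eval₂_C]
  have hQ0 : ∏ s : K ≃ₐ[k] K, s w = algebraMap k K (Q.eval 0) := by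
    rw [← Polynomial.eval_zero_map, hQ, Polynomial.eval_prod]
    simp
  have hQne : Q.eval 0 ≠ 0 := fun h0 => by
    rw [h0, map_zero, Finset.prod_eq_zero_iff] at hQ0
    obtain ⟨s, -, hs⟩ := hQ0
    simp [hw] at hs
  have hN3 : ∏ s : K ≃ₐ[k] K, galBaseChange O s (iK w⁻¹)
      = algebraMap O (O ⊗[k] K) (algebraMap k O (Q.eval 0)⁻¹) := by
    simp only [hgal]
    rw [← map_prod, ← hiK, map_inv₀ (algebraMap k K), ← hQ0, ← Finset.prod_inv_distrib]
    simp only [map_inv₀]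
  have hjac := HenselianRing.jac (R := O) (I := Ideal.span {π})
  have hc0 : IsUnit (t + π * r') := by
    obtain ⟨v, hv⟩ := ht
    have h1 := Ideal.mem_jacobson_bot.mp (hjac (Ideal.mem_span_singleton_self π)) (r' * ↑v⁻¹)
    have h2 : t + π * r' = (π * (r' * ↑v⁻¹) + 1) * v := by
      linear_combination -hv - π * r' * v.inv_mul
    rw [h2]
    exact h1.mul v.isUnit
  obtain ⟨c0, hc0⟩ := hc0
  set n := algebraMap k O (Q.eval 0) with hn
  have hnn : n * algebraMap k O (Q.eval 0)⁻¹ = 1 := by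
    rw [hn, ← map_mul, mul_inv_cancel₀ hQne, map_one]
  -- The zero ring is set apart since a monic polynomial keeps its degree only over a nontrivial
  -- ring.
  rcases subsingleton_or_nontrivial O with hnt | hnt
  · have : Subsingleton (O ⊗[k] K) := Module.subsingleton O _
    exact ⟨0, Subsingleton.elim _ _⟩
  -- Solve `Q(x) = Q(0) t / (t + π r')`. The right side is `Q(0)` modulo `π`, so `0` is an
  -- approximate root, and it is simple since `Q'(0) ≠ 0`. The factor `(x + w) / w` then has norm `t
  -- / (t + π r')` and corrects the norm `t + π r'` found modulo `p`.
  obtain ⟨x, hx, -⟩ := HenselianRing.is_henselian (R := O) (I := Ideal.span {π})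
    (Q.map (algebraMap k O) - C (n * t * ↑c0⁻¹))
    ((hQm.map _).sub_of_left (lt_of_le_of_lt degree_C_le (by rwa [hQm.degree_map]))) 0 (by
      rw [eval_sub, eval_C, Polynomial.eval_zero_map, ← hn, Ideal.mem_span_singleton]
      refine ⟨n * r' * ↑c0⁻¹, ?_⟩
      have : (t + π * r') * ↑c0⁻¹ = 1 := by rw [← hc0, Units.mul_inv]
      linear_combination -n * this) (by
      rw [derivative_sub, derivative_C, sub_zero, derivative_map, Polynomial.eval_zero_map]
      exact ((isUnit_iff_ne_zero.mpr hQ').map (algebraMap k O)).map _)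
  rw [IsRoot.def, eval_sub, eval_C, sub_eq_zero, eval_map] at hx
  refine ⟨h.eval₂ iK (algebraMap O _ t) * (algebraMap O _ x + iK w) * iK w⁻¹, ?_⟩
  simp only [map_mul, Finset.prod_mul_distrib]
  rw [hN1, hN2, hN3, hx, ← map_mul, ← map_mul]
  congr 1
  calc (t + π * r') * (n * t * ↑c0⁻¹) * algebraMap k O (Q.eval 0)⁻¹
      = (n * algebraMap k O (Q.eval 0)⁻¹) * t * ((t + π * r') * ↑c0⁻¹) := by ring
    _ = t := by rw [hnn, ← hc0, Units.mul_inv, one_mul, mul_one]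

end HenselNorm

/-! ### Splitting `K{τ}` over a Henselian ring -/

namespace SkewPoly

variable {k K : Type*} [Field k] [Fintype k] [Field K] [Algebra k K]

/-- The universal property of `K{τ}`. -/
def lift {A : Type*} [Ring A] (φ : K →+* A) (D : A)
    (h : ∀ a, D * φ a = φ (a ^ Fintype.card k) * D) : SkewPoly k K →+* A :=
  letI := frobeniusAction k K
  SkewMonoidAlgebra.liftNCRingHom (k := K) (G := Multiplicative ℕ) φ (powersHom A D) (by
    have key : ∀ (n : ℕ) (a : K), φ (a ^ Fintype.card k ^ n) * D ^ n = D ^ n * φ a := by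
      intro n
      induction n with
      | zero => simp
      | succ n ih =>
        intro a
        rw [pow_succ' D, mul_assoc, ← ih, ← mul_assoc, ← mul_assoc, h, ← pow_mul, ← pow_succ]
    intro a y
    have hy : y • a = a ^ Fintype.card k ^ (Multiplicative.toAdd y) := by
      have h1 := SkewPolynomial.φ_iterate_apply (R := K) (Multiplicative.toAdd y) a
      rw [frobenius_iterate k K] at h1
      exact h1.symm
    rw [hy]
    exact key _ a)

lemma lift_C {A : Type*} [Ring A] (φ : K →+* A) (D : A)
    (h : ∀ a, D * φ a = φ (a ^ Fintype.card k) * D) (a : K) : lift φ D h (C k K a) = φ a := by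
  let := frobeniusAction k K
  refine (SkewMonoidAlgebra.liftNC_single (k := K) (φ : K →+ A) (powersHom A D) 1 a).trans ?_
  simp

lemma lift_τ {A : Type*} [Ring A] (φ : K →+* A) (D : A)
    (h : ∀ a, D * φ a = φ (a ^ Fintype.card k) * D) : lift φ D h (τ k K) = D := by
  let := frobeniusAction k K
  refine (SkewMonoidAlgebra.liftNC_single (k := K) (φ : K →+ A) (powersHom A D)
    (Multiplicative.ofAdd 1) 1).trans ?_
  simp

end SkewPoly

section Splitting

variable {k K : Type*} [Field k] [Fintype k] [Field K] [Algebra k K] [FiniteDimensional k K]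
variable {O : Type*} [CommRing O]

section Injective

variable [Algebra k[X] O]

/-- The source has `d ^ 2` generators and the target is free of rank `d ^ 2`. Composing yields a
surjective endomorphism of `O ^ (d ^ 2)`, which is injective over a commutative ring; no basis of
the source is needed. -/
lemma injective_of_surjective_matrix
    (Ψ : (O ⊗[k[X]] SkewPoly k K) →ₗ[O]
      Matrix (Fin (Module.finrank k K)) (Fin (Module.finrank k K)) O)
    (hsurj : Function.Surjective Ψ) : Function.Injective Ψ := by
  let b := Module.finBasis k K
  let ι := Fin (Module.finrank k K)
  let g : (ι × ι → O) →ₗ[O] O ⊗[k[X]] SkewPoly k K :=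
    Fintype.linearCombination O fun x : ι × ι =>
      (1 : O) ⊗ₜ[k[X]] (SkewPoly.C k K (b x.1) * SkewPoly.τ k K ^ (x.2 : ℕ))
  have hg : Function.Surjective g := by
    rw [← LinearMap.range_eq_top, Fintype.range_linearCombination, eq_top_iff]
    rintro z -
    induction z using TensorProduct.induction_on with
    | zero => exact Submodule.zero_mem _
    | add y z hy hz => exact Submodule.add_mem _ hy hz
    | tmul x f =>
      have hf : f ∈ Submodule.span k[X] (Set.range fun x : ι × ι =>
          SkewPoly.C k K (b x.1) * SkewPoly.τ k K ^ (x.2 : ℕ)) := by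
        rw [SkewPoly.span_C_mul_τ_pow b]
        trivial
      have hx : x ⊗ₜ[k[X]] f = x • ((1 : O) ⊗ₜ[k[X]] f) := by
        rw [TensorProduct.smul_tmul', smul_eq_mul, mul_one]
      rw [hx]
      refine Submodule.smul_mem _ _ ?_
      clear hx
      induction hf using Submodule.span_induction with
      | mem f h =>
        obtain ⟨y, rfl⟩ := h
        exact Submodule.subset_span ⟨y, rfl⟩
      | zero => rw [TensorProduct.tmul_zero]; exact Submodule.zero_mem _
      | add f g _ _ hf hg => rw [TensorProduct.tmul_add]; exact Submodule.add_mem _ hf hg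
      | smul a f _ hf =>
        rw [TensorProduct.tmul_smul, ← algebraMap_smul O a]
        exact Submodule.smul_mem _ _ hf
  let m : Matrix ι ι O ≃ₗ[O] (ι × ι → O) :=
    (LinearEquiv.curry O O ι ι).symm
  have hcomp : Function.Injective (m.toLinearMap ∘ₗ Ψ ∘ₗ g) := by
    apply OrzechProperty.injective_of_surjective_endomorphism
    exact m.surjective.comp (hsurj.comp hg)
  intro y z hyz
  obtain ⟨y, rfl⟩ := hg y
  obtain ⟨z, rfl⟩ := hg z
  exact congrArg g (hcomp (congrArg m hyz))

end Injective

variable [Algebra k O]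

/-- A subalgebra of `End (O ⊗ K)` that contains the multiplications and the Galois group is
everything. -/
lemma subalgebra_end_eq_top (B : Subalgebra O (Module.End O (O ⊗[k] K)))
    (hmul : ∀ a : K, LinearMap.mulLeft O ((1 : O) ⊗ₜ[k] a) ∈ B)
    (hgal : ∀ s : K ≃ₐ[k] K, (galBaseChange O s).toLinearMap ∈ B) : B = ⊤ := by
  have := isGalois_of_finite (k := k) (K := K)
  -- Dedekind: the `d` automorphisms are linearly independent over `K`, hence a basis of the
  -- `d`-dimensional `K`-space `End_k K`.
  have hspan : Submodule.span K (Set.range (AlgHom.toLinearMap : (K →ₐ[k] K) → K →ₗ[k] K)) = ⊤ := by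
    refine (linearIndependent_toLinearMap k K K).span_eq_top_of_card_eq_finrank ?_
    rw [Module.finrank_linearMap_self, ← Nat.card_eq_fintype_card,
      ← Nat.card_congr (Algebra.IsAlgebraic.algEquivEquivAlgHom k K).toEquiv,
      IsGalois.card_aut_eq_finrank]
  have hbase : ∀ E : K →ₗ[k] K, E.baseChange O ∈ B := by
    intro E
    have hE : E ∈ Submodule.span K (Set.range (AlgHom.toLinearMap : (K →ₐ[k] K) → K →ₗ[k] K)) := by
      rw [hspan]
      trivial
    induction hE using Submodule.span_induction with
    | mem E h =>
      obtain ⟨s, rfl⟩ := h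
      obtain ⟨s, rfl⟩ := (Algebra.IsAlgebraic.algEquivEquivAlgHom k K).surjective s
      exact hgal s
    | zero => rw [LinearMap.baseChange_zero]; exact B.zero_mem
    | add E E' _ _ h h' => rw [LinearMap.baseChange_add]; exact B.add_mem h h'
    | smul a E _ h =>
      have h1 : (a • E).baseChange O = LinearMap.mulLeft O ((1 : O) ⊗ₜ[k] a) * E.baseChange O := by
        apply TensorProduct.AlgebraTensorModule.ext
        intro x b
        simp
      rw [h1]
      exact B.mul_mem (hmul a) h
  rw [eq_top_iff]
  rintro f -
  let b := Module.finBasis k K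
  rw [← ((Algebra.TensorProduct.basis O b).end).sum_repr f]
  refine B.sum_mem fun ij _ => B.smul_mem ?_ _
  rw [← b.baseChange_end O ij]
  exact hbase _

/-- The semilinear operator `y ↦ u σ (y)` of `O ⊗ K`, where `σ` is the Frobenius. -/
def frobeniusOperator (u : O ⊗[k] K) : Module.End O (O ⊗[k] K) :=
  LinearMap.mulLeft O u *
    (galBaseChange O (FiniteField.frobeniusAlgEquivOfAlgebraic k K)).toLinearMap

/-- This is the defining relation of `τ`, as `SkewPoly.lift` requires it. -/
lemma frobeniusOperator_mul (u : O ⊗[k] K) (a : K) :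
    frobeniusOperator u * LinearMap.mulLeft O ((1 : O) ⊗ₜ[k] a)
      = LinearMap.mulLeft O ((1 : O) ⊗ₜ[k] (a ^ Fintype.card k)) * frobeniusOperator u := by
  apply LinearMap.ext
  intro y
  change u * galBaseChange O _ ((1 : O) ⊗ₜ[k] a * y)
    = ((1 : O) ⊗ₜ[k] (a ^ Fintype.card k)) * (u * galBaseChange O _ y)
  rw [map_mul, galBaseChange_tmul, FiniteField.coe_frobeniusAlgEquivOfAlgebraic]
  ring

lemma frobeniusOperator_pow (u : O ⊗[k] K) (n : ℕ) :
    frobeniusOperator u ^ n = LinearMap.mulLeft O (∏ i ∈ Finset.range n,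
      galBaseChange O (FiniteField.frobeniusAlgEquivOfAlgebraic k K ^ i) u) *
      (galBaseChange O (FiniteField.frobeniusAlgEquivOfAlgebraic k K ^ n)).toLinearMap := by
  set σ := FiniteField.frobeniusAlgEquivOfAlgebraic k K with hσ
  induction n with
  | zero =>
    apply TensorProduct.AlgebraTensorModule.ext
    intro x a
    simp
  | succ n ih =>
    rw [pow_succ', ih]
    apply LinearMap.ext
    intro y
    change u * galBaseChange O σ ((∏ i ∈ Finset.range n, galBaseChange O (σ ^ i) u) *
      galBaseChange O (σ ^ n) y) = (∏ i ∈ Finset.range (n + 1), galBaseChange O (σ ^ i) u) *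
      galBaseChange O (σ ^ (n + 1)) y
    have h1 : ∀ (i : ℕ) z, galBaseChange O σ (galBaseChange O (σ ^ i) z)
        = galBaseChange O (σ ^ (i + 1)) z := fun i z => by
      rw [pow_succ', galBaseChange_mul]
      rfl
    have h0 : galBaseChange O (σ ^ 0) u = u := by
      rw [pow_zero, galBaseChange_one]
      rfl
    rw [map_mul, map_prod, Finset.prod_range_succ', h0]
    simp only [h1]
    ring

/-- The powers `σ ^ i` with `i < d` run through the Galois group once, so the product `u σ(u) ⋯` is
the norm of `u`, while `σ ^ d = 1`. Thus an equation `N(u) = t` makes the action of `K{τ}` linear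
over `k[t]`. -/
lemma frobeniusOperator_pow_finrank (u : O ⊗[k] K) (t : O)
    (hu : ∏ s : K ≃ₐ[k] K, galBaseChange O s u = algebraMap O (O ⊗[k] K) t) :
    frobeniusOperator u ^ Module.finrank k K = algebraMap O _ t := by
  have : Finite K := Module.finite_of_finite k
  have h1 : ∏ i ∈ Finset.range (Module.finrank k K),
      galBaseChange O (FiniteField.frobeniusAlgEquivOfAlgebraic k K ^ i) u
        = ∏ s : K ≃ₐ[k] K, galBaseChange O s u := by
    rw [Finset.prod_range]
    exact Fintype.prod_bijective _
      (FiniteField.bijective_frobeniusAlgEquivOfAlgebraic_pow k K) _ _ fun i => rfl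
  have h2 : FiniteField.frobeniusAlgEquivOfAlgebraic k K ^ Module.finrank k K = 1 := by
    rw [← FiniteField.orderOf_frobeniusAlgEquivOfAlgebraic k K]
    exact pow_orderOf_eq_one _
  rw [frobeniusOperator_pow, h1, hu, h2, galBaseChange_one]
  apply LinearMap.ext
  intro y
  exact (Algebra.smul_def t y).symm

/-- The multiplications by elements of `K` and a Frobenius operator generate `End (O ⊗ K)`. -/
lemma subalgebra_end_eq_top_of_frobeniusOperator (B : Subalgebra O (Module.End O (O ⊗[k] K)))
    (hmul : ∀ a : K, LinearMap.mulLeft O ((1 : O) ⊗ₜ[k] a) ∈ B) (u : O ⊗[k] K) (hu : IsUnit u)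
    (hB : frobeniusOperator u ∈ B) : B = ⊤ := by
  have : Finite K := Module.finite_of_finite k
  have hmul' : ∀ y : O ⊗[k] K, LinearMap.mulLeft O y ∈ B := by
    intro y
    induction y using TensorProduct.induction_on with
    | zero =>
      rw [LinearMap.mulLeft_zero_eq_zero]
      exact B.zero_mem
    | tmul x a =>
      have : LinearMap.mulLeft O (x ⊗ₜ[k] a) = x • LinearMap.mulLeft O ((1 : O) ⊗ₜ[k] a) := by
        apply LinearMap.ext
        intro z
        change x ⊗ₜ[k] a * z = x • ((1 : O) ⊗ₜ[k] a * z)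
        rw [← smul_mul_assoc, TensorProduct.smul_tmul', smul_eq_mul, mul_one]
      rw [this]
      exact B.smul_mem (hmul a) x
    | add y z hy hz =>
      have : LinearMap.mulLeft O (y + z) = LinearMap.mulLeft O y + LinearMap.mulLeft O z := by
        apply LinearMap.ext
        intro w
        exact add_mul y z w
      rw [this]
      exact B.add_mem hy hz
  -- Dividing by the unit `u` recovers the Frobenius itself, whose powers exhaust the Galois group.
  have hσ : (galBaseChange O (FiniteField.frobeniusAlgEquivOfAlgebraic k K)).toLinearMap ∈ B := by
    obtain ⟨v, hv⟩ := hu.exists_left_inv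
    have : (galBaseChange O (FiniteField.frobeniusAlgEquivOfAlgebraic k K)).toLinearMap
        = LinearMap.mulLeft O v * frobeniusOperator u := by
      apply LinearMap.ext
      intro y
      change galBaseChange O _ y = v * (u * galBaseChange O _ y)
      rw [← mul_assoc, hv, one_mul]
    rw [this]
    exact B.mul_mem (hmul' v) hB
  refine subalgebra_end_eq_top B hmul fun s => ?_
  obtain ⟨n, rfl⟩ := (FiniteField.bijective_frobeniusAlgEquivOfAlgebraic_pow k K).2 s
  obtain ⟨n, hn⟩ := n
  dsimp only
  clear hn
  induction n with
  | zero =>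
    rw [pow_zero, galBaseChange_one]
    exact B.one_mem
  | succ n ih =>
    rw [pow_succ, galBaseChange_mul]
    exact B.mul_mem ih hσ

variable [Algebra k[X] O] [IsScalarTower k k[X] O]

/-- If `O` is Henselian at the image of `p` and the image of `t` in `O` is a unit, then `K{τ}`
splits over `O`. -/
theorem nonempty_splitting {p : k[X]} (hp : Irreducible p)
    [HenselianRing O (Ideal.span {algebraMap k[X] O p})] (ht : IsUnit (algebraMap k[X] O X)) :
    Nonempty ((O ⊗[k[X]] SkewPoly k K) ≃ₐ[O]
      Matrix (Fin (Module.finrank k K)) (Fin (Module.finrank k K)) O) := by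
  obtain ⟨u, hu⟩ := exists_prod_galBaseChange_eq (K := K) (O := O) hp ht
  -- The element `u` is one of the factors of its norm `t`, a unit.
  have huu : IsUnit u := by
    have h1 : IsUnit (∏ s : K ≃ₐ[k] K, galBaseChange O s u) := by
      rw [hu]
      exact ht.map _
    have h2 : IsUnit (galBaseChange O (1 : K ≃ₐ[k] K) u) :=
      isUnit_of_dvd_unit (Finset.dvd_prod_of_mem (fun s : K ≃ₐ[k] K => galBaseChange O s u)
        (Finset.mem_univ 1)) h1
    rwa [galBaseChange_one] at h2
  have hDd := frobeniusOperator_pow_finrank u _ hu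
  let e : Module.End O (O ⊗[k] K) ≃ₐ[O]
      Matrix (Fin (Module.finrank k K)) (Fin (Module.finrank k K)) O :=
    LinearMap.toMatrixAlgEquiv (Algebra.TensorProduct.basis O (Module.finBasis k K))
  let mulK : K →+* Module.End O (O ⊗[k] K) :=
    ((Algebra.lmul O (O ⊗[k] K)).toRingHom).comp
      (Algebra.TensorProduct.includeRight : K →ₐ[k] O ⊗[k] K).toRingHom
  let ρ₀ : SkewPoly k K →+* Matrix (Fin (Module.finrank k K)) (Fin (Module.finrank k K)) O :=
    e.toRingEquiv.toRingHom.comp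
      (SkewPoly.lift mulK (frobeniusOperator u) (frobeniusOperator_mul u))
  have hρC : ∀ a, ρ₀ (SkewPoly.C k K a) = e (mulK a) := fun a =>
    congrArg e (SkewPoly.lift_C mulK (frobeniusOperator u) (frobeniusOperator_mul u) a)
  have hρτ : ρ₀ (SkewPoly.τ k K) = e (frobeniusOperator u) :=
    congrArg e (SkewPoly.lift_τ mulK (frobeniusOperator u) (frobeniusOperator_mul u))
  have hmulK : ∀ c : k, mulK (algebraMap k K c) = algebraMap O _ (algebraMap k[X] O (C c)) := by
    intro c
    apply TensorProduct.AlgebraTensorModule.ext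
    intro x a
    change ((1 : O) ⊗ₜ[k] algebraMap k K c) * (x ⊗ₜ[k] a) = algebraMap k[X] O (C c) • (x ⊗ₜ[k] a)
    have h1 : algebraMap k[X] O (C c) = algebraMap k O c :=
      (IsScalarTower.algebraMap_apply k k[X] O c).symm
    rw [h1, algebraMap_smul, Algebra.TensorProduct.tmul_mul_tmul, one_mul,
      ← Algebra.smul_def, TensorProduct.tmul_smul]
  have hρ : ∀ g : k[X], ρ₀ (algebraMap k[X] (SkewPoly k K) g)
      = algebraMap O _ (algebraMap k[X] O g) := by
    intro g
    induction g using Polynomial.induction_on' with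
    | add f g hf hg => simp only [map_add, hf, hg]
    | monomial n c =>
      simp only [← C_mul_X_pow_eq_monomial, map_mul, map_pow]
      rw [SkewPoly.algebraMap_C, SkewPoly.algebraMap_X, hρC, map_pow, hρτ, ← map_pow, hDd,
        AlgEquiv.commutes, hmulK, AlgEquiv.commutes]
  let ρ : SkewPoly k K →ₐ[k[X]]
      Matrix (Fin (Module.finrank k K)) (Fin (Module.finrank k K)) O :=
    { ρ₀ with
      commutes' := fun g => (hρ g).trans (IsScalarTower.algebraMap_apply k[X] O _ g).symm }
  let Ψ : (O ⊗[k[X]] SkewPoly k K) →ₐ[O]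
      Matrix (Fin (Module.finrank k K)) (Fin (Module.finrank k K)) O :=
    Algebra.TensorProduct.lift (Algebra.ofId O _) ρ fun x f => Algebra.commutes x (ρ f)
  have hΨ : ∀ f, Ψ (1 ⊗ₜ f) = ρ₀ f := fun f => by
    change Algebra.ofId O _ 1 * ρ f = _
    rw [map_one, one_mul]
    rfl
  have hsurj : Function.Surjective Ψ := by
    have hB := subalgebra_end_eq_top_of_frobeniusOperator (Ψ.range.comap e.toAlgHom)
      (fun a => ⟨1 ⊗ₜ SkewPoly.C k K a, (hΨ _).trans (hρC a)⟩) u huu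
      ⟨1 ⊗ₜ SkewPoly.τ k K, (hΨ _).trans hρτ⟩
    intro M
    have hM : e.symm M ∈ Ψ.range.comap e.toAlgHom := by
      rw [hB]
      trivial
    obtain ⟨z, hz⟩ := hM
    exact ⟨z, hz.trans (e.apply_symm_apply M)⟩
  exact ⟨AlgEquiv.ofBijective Ψ ⟨injective_of_surjective_matrix Ψ.toLinearMap hsurj, hsurj⟩⟩

/-- `K{τ}` splits over the completion at `p`. -/
theorem nonempty_localSplitting {p : k[X]} (hp : Irreducible p) (hp0 : p.eval 0 ≠ 0) :
    Nonempty (LocalSplitting k K hp) := by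
  let : Algebra k (LocalRing hp) := ((algebraMap k[X] (LocalRing hp)).comp C).toAlgebra
  have : IsScalarTower k k[X] (LocalRing hp) := .of_algebraMap_eq fun _ => rfl
  exact nonempty_splitting hp (isUnit_algebraMap_X hp hp0)

end Splitting

/-! ### Lattices, neighbors, and the building as a flag complex -/

section BuildingTheory

variable {O F : Type*} [CommRing O] [Field F] [Algebra O F] {n : ℕ}

namespace Lattice

lemma le_def {L M : Lattice O F n} : L ≤ M ↔ L.1 ≤ M.1 := Iff.rfl

lemma map_le_map_iff {e : (Fin n → F) ≃ₗ[F] (Fin n → F)} {L M : Lattice O F n} :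
    L.map e ≤ M.map e ↔ L ≤ M := by
  rw [le_def, le_def]
  exact Submodule.map_le_map_iff_of_injective
    (f := (e : (Fin n → F) →ₗ[F] (Fin n → F)).restrictScalars O) e.injective _ _

lemma map_lt_map_iff {e : (Fin n → F) ≃ₗ[F] (Fin n → F)} {L M : Lattice O F n} :
    L.map e < M.map e ↔ L < M := by
  simp only [lt_iff_le_not_ge, map_le_map_iff]

lemma scale_le_scale_iff {c : Fˣ} {L M : Lattice O F n} : L.scale c ≤ M.scale c ↔ L ≤ M :=
  map_le_map_iff

lemma scale_lt_scale_iff {c : Fˣ} {L M : Lattice O F n} : L.scale c < M.scale c ↔ L < M :=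
  map_lt_map_iff

lemma map_scale (e : (Fin n → F) ≃ₗ[F] (Fin n → F)) (c : Fˣ) (L : Lattice O F n) :
    (L.scale c).map e = (L.map e).scale c := by
  apply Lattice.ext
  ext x
  simp only [mem_scale, mem_map]
  constructor
  · rintro ⟨_, ⟨y, hy, rfl⟩, rfl⟩
    exact ⟨_, ⟨y, hy, rfl⟩, by simp⟩
  · rintro ⟨_, ⟨y, hy, rfl⟩, rfl⟩
    exact ⟨_, ⟨y, hy, rfl⟩, by simp⟩

lemma scale_scale_inv (c : Fˣ) (L : Lattice O F n) : (L.scale c⁻¹).scale c = L := by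
  rw [scale_scale, mul_inv_cancel, scale_one]

lemma scale_le {c : Fˣ} {a : O} (h : algebraMap O F a = c) (L : Lattice O F n) :
    L.scale c ≤ L := by
  intro x hx
  obtain ⟨y, hy, rfl⟩ := mem_scale.mp hx
  rw [← h, algebraMap_smul]
  exact L.1.smul_mem a hy

lemma scale_eq {c : Fˣ} {a : Oˣ} (h : algebraMap O F a = c) (L : Lattice O F n) :
    L.scale c = L := by
  refine le_antisymm (scale_le h L) ?_
  have h' : algebraMap O F ↑a⁻¹ = ((c⁻¹ : Fˣ) : F) := by
    rw [Units.val_inv_eq_inv_val, ← h]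
    exact eq_inv_of_mul_eq_one_left (by rw [← map_mul, Units.inv_mul, map_one])
  have := scale_le_scale_iff (c := c).mpr (scale_le h' L)
  rwa [scale_scale_inv] at this

end Lattice

lemma Vertex.mk_eq_mk_iff {L M : Lattice O F n} :
    Vertex.mk L = Vertex.mk M ↔ ∃ c : Fˣ, M = L.scale c := Quotient.eq

lemma Vertex.mk_scale (c : Fˣ) (L : Lattice O F n) : Vertex.mk (L.scale c) = Vertex.mk L :=
  (Vertex.mk_eq_mk_iff.mpr ⟨c, rfl⟩).symm

lemma Vertex.exists_mk (x : Vertex O F n) : ∃ L, Vertex.mk L = x := Quotient.exists_rep x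

section Neighbors

variable {π : Fˣ} {L M N : Lattice O F n}

lemma IsNeighbor.map (h : IsNeighbor π L M) (e : (Fin n → F) ≃ₗ[F] (Fin n → F)) :
    IsNeighbor π (L.map e) (M.map e) :=
  ⟨Lattice.map_lt_map_iff.mpr h.1, by
    rw [← Lattice.map_scale]
    exact Lattice.map_lt_map_iff.mpr h.2⟩

lemma IsNeighbor.scale (h : IsNeighbor π L M) (c : Fˣ) : IsNeighbor π (L.scale c) (M.scale c) :=
  h.map _

lemma IsNeighbor.smul (h : IsNeighbor π L M) (g : GL (Fin n) F) : IsNeighbor π (g • L) (g • M) :=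
  h.map _

/-- An edge is reversed by moving one step down the periodic chain `L ⊋ M ⊋ π L ⊋ π M`. -/
lemma IsNeighbor.symm (h : IsNeighbor π L M) : IsNeighbor π M (L.scale π) :=
  ⟨h.2, Lattice.scale_lt_scale_iff.mpr h.1⟩

lemma latticeLabel_map (L M : Lattice O F n) (e : (Fin n → F) ≃ₗ[F] (Fin n → F)) :
    latticeLabel π (L.map e) (M.map e) = latticeLabel π L M := by
  unfold latticeLabel
  rw [← Lattice.map_scale]
  generalize L.scale π = L
  let f : M.1 ≃ₗ[O] (M.map e).1 := (e.restrictScalars O).submoduleMap M.1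
  refine (LinearEquiv.length_eq (Submodule.Quotient.equiv (L.1.submoduleOf M.1)
    ((L.map e).1.submoduleOf (M.map e).1) f ?_)).symm
  ext x
  rw [Submodule.mem_map]
  constructor
  · rintro ⟨y, hy, rfl⟩
    exact Lattice.mem_map.mpr ⟨y, hy, rfl⟩
  · intro hx
    obtain ⟨y, hy, hyx⟩ := Lattice.mem_map.mp hx
    refine ⟨f.symm x, ?_, f.apply_symm_apply x⟩
    have h1 : e (f.symm x : M.1) = e y :=
      (congrArg Subtype.val (f.apply_symm_apply x)).trans hyx.symm
    change ((f.symm x : M.1) : Fin n → F) ∈ L.1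
    rwa [e.injective h1]

lemma latticeLabel_scale (L M : Lattice O F n) (c : Fˣ) :
    latticeLabel π (L.scale c) (M.scale c) = latticeLabel π L M := latticeLabel_map L M _

lemma latticeLabel_smul (L M : Lattice O F n) (g : GL (Fin n) F) :
    latticeLabel π (g • L) (g • M) = latticeLabel π L M := latticeLabel_map L M _

/-- The vertices `x` and `y` are joined by an edge of the building. -/
def Neighbors (π : Fˣ) (x y : Vertex O F n) : Prop :=
  ∃ L M : Lattice O F n, Vertex.mk L = x ∧ Vertex.mk M = y ∧ IsNeighbor π L M

lemma Neighbors.symm {x y : Vertex O F n} (h : Neighbors π x y) : Neighbors π y x := by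
  obtain ⟨L, M, rfl, rfl, h⟩ := h
  exact ⟨M, L.scale π, rfl, Vertex.mk_scale π L, h.symm⟩

/-- Scaling both lattices at once reaches any prescribed representative of the first vertex. The
equation for `L` is recorded because labels are transported by the same scalar. -/
lemma exists_isNeighbor_of_mk_eq {x : Vertex O F n} (h : IsNeighbor π N M)
    (hN : Vertex.mk N = x) (hL : Vertex.mk L = x) :
    ∃ c : Fˣ, IsNeighbor π L (M.scale c) ∧ L = N.scale c := by
  obtain ⟨c, rfl⟩ := Vertex.mk_eq_mk_iff.mp (hN.trans hL.symm)
  exact ⟨c, h.scale c, rfl⟩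

lemma Neighbors.exists_isNeighbor {y : Vertex O F n} (h : Neighbors π (Vertex.mk L) y) :
    ∃ M, Vertex.mk M = y ∧ IsNeighbor π L M := by
  obtain ⟨N, M, hN, rfl, h⟩ := h
  obtain ⟨c, hc, -⟩ := exists_isNeighbor_of_mk_eq h hN rfl
  exact ⟨M.scale c, Vertex.mk_scale c M, hc⟩

end Neighbors

/-- The element `π` of `F` is a uniformizer of `O`: every element of `Fˣ` is the product of a power
of `π` and a unit of `O`. -/
structure IsUniformizer (O : Type*) {F : Type*} [CommRing O] [Field F] [Algebra O F]
    (π : Fˣ) : Prop where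
  exists_algebraMap_eq : ∃ a : O, algebraMap O F a = π
  not_isUnit : ∀ a : O, algebraMap O F a = π → ¬ IsUnit a
  exists_zpow_mul : ∀ c : Fˣ, ∃ (j : ℤ) (u : Oˣ), (c : F) = (π : F) ^ j * algebraMap O F u

section Uniformizer

variable {π : Fˣ} (hπ : IsUniformizer O π) {L M N : Lattice O F n}

include hπ

/-- Units of `O` preserve every lattice, so only the power of `π` in a scalar matters. -/
lemma IsUniformizer.exists_eq_scale_zpow (h : Vertex.mk L = Vertex.mk M) :
    ∃ j : ℤ, M = L.scale (π ^ j) := by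
  obtain ⟨c, rfl⟩ := Vertex.mk_eq_mk_iff.mp h
  obtain ⟨j, u, hc⟩ := hπ.exists_zpow_mul c
  have hc' : c = π ^ j * Units.map (algebraMap O F).toMonoidHom u := by
    apply Units.ext
    simpa using hc
  refine ⟨j, ?_⟩
  rw [hc', ← Lattice.scale_scale, Lattice.scale_eq
    (c := Units.map (algebraMap O F).toMonoidHom u) (a := u) rfl]

lemma IsUniformizer.scale_pow_le (L : Lattice O F n) (m : ℕ) : L.scale (π ^ m) ≤ L := by
  obtain ⟨a, ha⟩ := hπ.exists_algebraMap_eq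
  exact Lattice.scale_le (a := a ^ m) (by rw [map_pow, ha, Units.val_pow_eq_pow_val]) L

lemma IsUniformizer.scale_zpow_le {i j : ℤ} (h : i ≤ j) (L : Lattice O F n) :
    L.scale (π ^ j) ≤ L.scale (π ^ i) := by
  obtain ⟨m, rfl⟩ := Int.le.dest h
  rw [zpow_add, ← Lattice.scale_scale, zpow_natCast]
  exact Lattice.scale_le_scale_iff.mpr (hπ.scale_pow_le L m)

/-- The lattices `π ^ j L` form a chain in which nothing lies strictly between `π L` and `L`. -/
lemma IsUniformizer.mk_ne_mk (h : IsNeighbor π L M) : Vertex.mk L ≠ Vertex.mk M := by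
  intro he
  obtain ⟨j, rfl⟩ := hπ.exists_eq_scale_zpow he
  rcases le_or_gt j 0 with hj | hj
  · have := hπ.scale_zpow_le hj L
    rw [zpow_zero, Lattice.scale_one] at this
    exact h.1.not_ge this
  · have := hπ.scale_zpow_le (Int.add_one_le_iff.mpr hj) L
    rw [zero_add, zpow_one] at this
    exact h.2.not_ge this

/-- Write `N = π ^ j N'` with `π M ⊊ N' ⊊ M`. Since `M` and `N` both lie strictly between `π L` and
`L`, only `j = 0` and `j = -1` survive, and these give the two inclusions. -/
lemma IsUniformizer.lt_or_lt (hM : IsNeighbor π L M) (hN : IsNeighbor π L N)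
    (h : Neighbors π (Vertex.mk M) (Vertex.mk N)) : M < N ∨ N < M := by
  obtain ⟨N', hN', hMN⟩ := h.exists_isNeighbor
  obtain ⟨j, rfl⟩ := hπ.exists_eq_scale_zpow hN'
  rcases lt_trichotomy j 0 with hj | rfl | hj
  · rcases (Int.le_sub_one_of_lt hj).lt_or_eq with hj | rfl
    -- For `j ≤ -2` there would be a cycle `L ⊊ π⁻¹ M ⊊ π⁻² N' ⊆ N ⊊ L`.
    · exfalso
      have h1 := hπ.scale_zpow_le (Int.le_sub_one_of_lt hj) N'
      have h2 : (M.scale π).scale (π ^ (0 - 1 - 1 : ℤ)) < N'.scale (π ^ (0 - 1 - 1 : ℤ)) :=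
        Lattice.scale_lt_scale_iff.mpr hMN.2
      have h3 : (L.scale π).scale (π ^ (0 - 1 : ℤ)) < M.scale (π ^ (0 - 1 : ℤ)) :=
        Lattice.scale_lt_scale_iff.mpr hM.2
      rw [Lattice.scale_scale, ← zpow_add_one] at h2 h3
      norm_num [Lattice.scale_one] at h1 h2 h3
      exact (((h3.trans h2).trans_le h1).trans hN.1).false
    · left
      have h2 : (M.scale π).scale (π ^ (0 - 1 : ℤ)) < N'.scale (π ^ (0 - 1 : ℤ)) :=
        Lattice.scale_lt_scale_iff.mpr hMN.2
      rw [Lattice.scale_scale, ← zpow_add_one] at h2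
      simpa [Lattice.scale_one] using h2
  · right
    rw [zpow_zero, Lattice.scale_one]
    exact hMN.1
  · exfalso
    have h1 := hπ.scale_zpow_le (Int.add_one_le_iff.mpr hj) N'
    rw [zero_add, zpow_one] at h1
    have h2 : N'.scale π < M.scale π := Lattice.scale_lt_scale_iff.mpr hMN.1
    have h3 : M.scale π < L.scale π := Lattice.scale_lt_scale_iff.mpr hM.1
    exact ((h1.trans_lt (h2.trans h3)).trans hN.2).false

/-- If `π L = L`, a basis vector of `L` is `π y` with `y ∈ L`; its own coordinate then exhibits an
inverse of `π` in `O`. This is where `n ≠ 0` enters. -/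
lemma IsUniformizer.scale_lt [NeZero n] (hO : Function.Injective (algebraMap O F))
    (L : Lattice O F n) : L.scale π < L := by
  obtain ⟨a, ha⟩ := hπ.exists_algebraMap_eq
  refine (Lattice.scale_le ha L).lt_of_ne fun he => ?_
  obtain ⟨b, hb⟩ := L.2
  have h0 : b 0 ∈ (L.scale π).1 := by
    rw [he, hb]
    exact Submodule.subset_span ⟨0, rfl⟩
  obtain ⟨y, hy, hyb⟩ := Lattice.mem_scale.mp h0
  rw [hb] at hy
  have hc : ∀ y ∈ Submodule.span O (Set.range b), ∃ c : O, algebraMap O F c = b.repr y 0 := by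
    intro y hy
    induction hy using Submodule.span_induction with
    | mem y h =>
      obtain ⟨i, rfl⟩ := h
      rw [b.repr_self, Finsupp.single_apply]
      split_ifs
      · exact ⟨1, map_one _⟩
      · exact ⟨0, map_zero _⟩
    | zero => exact ⟨0, by simp⟩
    | add y z _ _ hy hz =>
      obtain ⟨c, hc⟩ := hy
      obtain ⟨c', hc'⟩ := hz
      exact ⟨c + c', by simp [hc, hc']⟩
    | smul r y _ hy =>
      obtain ⟨c, hc⟩ := hy
      refine ⟨r * c, ?_⟩
      rw [← algebraMap_smul F r y, map_smul, map_mul, hc]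
      rfl
  obtain ⟨c, hc⟩ := hc y hy
  have h1 := congrArg (fun z => b.repr z 0) hyb
  simp only [map_smul, b.repr_self, Finsupp.smul_apply, Finsupp.single_eq_same, smul_eq_mul] at h1
  rw [← ha, ← hc, ← map_mul, ← map_one (algebraMap O F)] at h1
  exact hπ.not_isUnit a ha (IsUnit.of_mul_eq_one c (hO h1))

/-- The building is a flag complex: its simplices are the sets of pairwise neighboring vertices. -/
lemma IsUniformizer.mem_faces_iff [NeZero n] (hO : Function.Injective (algebraMap O F))
    (s : Finset (Vertex O F n)) : s ∈ (building π).faces ↔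
      s.Nonempty ∧ (s : Set (Vertex O F n)).Pairwise (Neighbors π) := by
  classical
  constructor
  · rintro ⟨r, L, hL, hLπ, hs⟩
    refine ⟨by rw [← Finset.coe_nonempty, hs]; exact Set.range_nonempty _, ?_⟩
    have key : ∀ i j, i < j → IsNeighbor π (L i) (L j) := fun i j hij =>
      ⟨hL hij, (Lattice.scale_le_scale_iff.mpr (hL.antitone (Fin.zero_le i))).trans_lt
        (hLπ.trans_le (hL.antitone (Fin.le_last j)))⟩
    rw [hs]
    rintro _ ⟨i, rfl⟩ _ ⟨j, rfl⟩ hne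
    rcases lt_trichotomy i j with h | rfl | h
    · exact ⟨L i, L j, rfl, rfl, key i j h⟩
    · exact absurd rfl hne
    · exact Neighbors.symm ⟨L j, L i, rfl, rfl, key j i h⟩
  · rintro ⟨⟨x₀, hx₀⟩, hs⟩
    obtain ⟨L, rfl⟩ := Vertex.exists_mk x₀
    -- Anchor all vertices at one lattice `L`: each gets a representative `M` with `π L ⊊ M ⊆ L`.
    -- Pairwise neighboring then makes these representatives a chain, by `lt_or_lt`.
    have hrep : ∀ y : s, ∃ M : Lattice O F n, Vertex.mk M = y.1 ∧ (M = L ∨ IsNeighbor π L M) := by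
      rintro ⟨y, hy⟩
      by_cases hyL : Vertex.mk L = y
      · exact ⟨L, hyL, Or.inl rfl⟩
      · obtain ⟨M, hM, hLM⟩ := (hs hx₀ hy hyL).exists_isNeighbor
        exact ⟨M, hM, Or.inr hLM⟩
    choose f hf hfL using hrep
    have hle : ∀ y, f y ≤ L := fun y => (hfL y).elim (fun h => h.le) fun h => h.1.le
    have hlt : ∀ y, L.scale π < f y := fun y =>
      (hfL y).elim (fun h => by rw [h]; exact hπ.scale_lt hO L) fun h => h.2
    have htotal : ∀ y z, f y ≤ f z ∨ f z ≤ f y := by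
      intro y z
      rcases hfL y with h | h
      · exact Or.inr (h ▸ hle z)
      rcases hfL z with h' | h'
      · exact Or.inl (h' ▸ hle y)
      by_cases hyz : y = z
      · exact Or.inl (by rw [hyz])
      have hn := hs y.2 z.2 fun h => hyz (Subtype.ext h)
      rw [← hf y, ← hf z] at hn
      exact (hπ.lt_or_lt h h' hn).imp le_of_lt le_of_lt
    have hinj : Function.Injective f := fun y z h => Subtype.ext (by rw [← hf, ← hf, h])
    -- Order the vertices by reverse inclusion of representatives, so that the increasing
    -- enumeration is a descending flag.
    let : PartialOrder s := PartialOrder.lift (fun y => OrderDual.toDual (f y))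
      (OrderDual.toDual.injective.comp hinj)
    let : LinearOrder s :=
      { (inferInstance : PartialOrder s) with
        le_total := fun y z => htotal z y
        toDecidableLE := Classical.decRel _ }
    obtain ⟨r, hr⟩ : ∃ r, Fintype.card s = r + 1 :=
      ⟨Fintype.card s - 1, (Nat.succ_pred_eq_of_pos (Fintype.card_pos_iff.mpr ⟨⟨_, hx₀⟩⟩)).symm⟩
    let o := monoEquivOfFin s hr
    refine ⟨r, fun i => f (o i), fun i j hij => o.strictMono hij, ?_, ?_⟩
    · exact (Lattice.scale_le_scale_iff.mpr (hle _)).trans_lt (hlt _)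
    · ext x
      constructor
      · intro hx
        obtain ⟨i, hi⟩ := o.surjective ⟨x, hx⟩
        exact ⟨i, by rw [Function.comp_apply, hi, hf]⟩
      · rintro ⟨i, rfl⟩
        rw [Function.comp_apply, hf]
        exact (o i).2

lemma IsUniformizer.oneSkeleton_adj_iff [NeZero n] (hO : Function.Injective (algebraMap O F))
    (x y : Vertex O F n) : (oneSkeleton (building π)).Adj x y ↔ Neighbors π x y := by
  classical
  constructor
  · rintro ⟨hne, s, hs, hsxy⟩
    exact ((hπ.mem_faces_iff hO s).mp hs).2 (by simp [hsxy]) (by simp [hsxy]) hne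
  · intro h
    have hne : x ≠ y := by
      obtain ⟨L, M, rfl, rfl, h⟩ := h
      exact hπ.mk_ne_mk h
    refine ⟨hne, {x, y}, (hπ.mem_faces_iff hO _).mpr ⟨by simp, ?_⟩, by simp⟩
    rw [Finset.coe_pair, Set.pairwise_pair]
    exact fun _ => ⟨h, h.symm⟩

end Uniformizer

end BuildingTheory

/-! ### Commensurability of lattices and integral matrices -/

section BuildingTheory

variable {O F : Type*} [CommRing O] [Field F] [Algebra O F] {n : ℕ}

lemma Lattice.mem_std {x : Fin n → F} :
    x ∈ (Lattice.std O F n).1 ↔ ∃ y : Fin n → O, algebraMap O F ∘ y = x := by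
  constructor
  · intro hx
    obtain ⟨c, rfl⟩ := (Submodule.mem_span_range_iff_exists_fun O).mp hx
    refine ⟨c, ?_⟩
    ext i
    simp [Finset.sum_apply, Pi.single_apply, Algebra.smul_def]
  · rintro ⟨y, rfl⟩
    refine (Submodule.mem_span_range_iff_exists_fun O).mpr ⟨y, ?_⟩
    ext i
    simp [Finset.sum_apply, Pi.single_apply, Algebra.smul_def]

/-- The bound holds for all larger exponents, so that one exponent can serve finitely many
coefficients. -/
lemma IsUniformizer.exists_pow_mul {π : Fˣ} (hπ : IsUniformizer O π) (c : F) :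
    ∃ m : ℕ, ∀ l, m ≤ l → ∃ a : O, algebraMap O F a = (π : F) ^ l * c := by
  rcases eq_or_ne c 0 with rfl | hc
  · exact ⟨0, fun l _ => ⟨0, by simp⟩⟩
  obtain ⟨j, u, hj⟩ := hπ.exists_zpow_mul (Units.mk0 c hc)
  rw [Units.val_mk0] at hj
  obtain ⟨a, ha⟩ := hπ.exists_algebraMap_eq
  refine ⟨(-j).toNat, fun l hl => ⟨a ^ (l + j).toNat * u, ?_⟩⟩
  rw [map_mul, map_pow, ha, hj, ← mul_assoc]
  congr 1
  rw [← zpow_natCast, ← zpow_natCast, ← zpow_add₀ π.ne_zero]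
  congr 1
  omega

/-- Clear the denominators of the matrix expressing a basis of `M` in a basis of `L`; the sum of the
individual exponents is a common bound. -/
lemma IsUniformizer.exists_scale_le {π : Fˣ} (hπ : IsUniformizer O π) (L M : Lattice O F n) :
    ∃ m : ℕ, M.scale (π ^ m) ≤ L := by
  obtain ⟨b, hb⟩ := L.2
  obtain ⟨b', hb'⟩ := M.2
  choose m hm using fun i j => hπ.exists_pow_mul (b.repr (b' i) j)
  refine ⟨∑ i, ∑ j, m i j, ?_⟩
  have hle : ∀ i j, m i j ≤ ∑ i, ∑ j, m i j := fun i j =>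
    (Finset.single_le_sum (f := fun j => m i j) (fun _ _ => Nat.zero_le _)
      (Finset.mem_univ j)).trans
    (Finset.single_le_sum (f := fun i => ∑ j, m i j) (fun _ _ => Nat.zero_le _)
      (Finset.mem_univ i))
  generalize ∑ i, ∑ j, m i j = l at hle
  intro x hx
  obtain ⟨y, hy, rfl⟩ := Lattice.mem_scale.mp hx
  rw [hb'] at hy
  rw [hb]
  induction hy using Submodule.span_induction with
  | mem y h =>
    obtain ⟨i, rfl⟩ := h
    choose a ha using fun j => hm i j l (hle i j)
    refine (Submodule.mem_span_range_iff_exists_fun O).mpr ⟨a, ?_⟩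
    conv_rhs => rw [← b.sum_repr (b' i), Finset.smul_sum]
    refine Finset.sum_congr rfl fun j _ => ?_
    rw [smul_smul, Units.val_pow_eq_pow_val, ← ha, algebraMap_smul]
  | zero => rw [smul_zero]; exact zero_mem _
  | add y z _ _ hy hz =>
    rw [smul_add]
    exact add_mem (hy (Lattice.mem_scale.mpr ⟨_, by rw [hb']; assumption, rfl⟩))
      (hz (Lattice.mem_scale.mpr ⟨_, by rw [hb']; assumption, rfl⟩))
  | smul r y _ hy =>
    rw [smul_comm]
    exact Submodule.smul_mem _ r (hy (Lattice.mem_scale.mpr ⟨_, by rw [hb']; assumption, rfl⟩))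

lemma Lattice.smul_std_le_iff {g : GL (Fin n) F} : g • Lattice.std O F n ≤ Lattice.std O F n ↔
    ∃ B : Matrix (Fin n) (Fin n) O, g.1 = B.map (algebraMap O F) := by
  constructor
  · intro h
    have hcol : ∀ j, ∃ y : Fin n → O, algebraMap O F ∘ y = g.1.col j := fun j => by
      refine Lattice.mem_std.mp (h (Lattice.mem_smul.mpr ⟨Pi.single j 1, ?_, ?_⟩))
      · exact Lattice.mem_std.mpr ⟨Pi.single j 1, by
          ext i; simp only [Function.comp_apply, Pi.single_apply]; split_ifs <;> simp⟩
      · exact Matrix.mulVec_single_one _ _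
    choose y hy using hcol
    refine ⟨Matrix.of fun i j => y j i, ?_⟩
    ext i j
    exact (congrFun (hy j) i).symm
  · rintro ⟨B, hB⟩ x hx
    obtain ⟨z, hz, rfl⟩ := Lattice.mem_smul.mp hx
    obtain ⟨y, rfl⟩ := Lattice.mem_std.mp hz
    refine Lattice.mem_std.mpr ⟨B.mulVec y, ?_⟩
    rw [hB]
    ext i
    exact RingHom.map_mulVec (algebraMap O F) B y i

end BuildingTheory

/-! ### Comparing `K{τ}` with its completion at `p` -/

section Arithmetic

variable {k : Type*} [Field k] {p : k[X]} {hp : Irreducible p}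

lemma algebraMap_localField_injective :
    Function.Injective (algebraMap (LocalRing hp) (LocalField hp)) :=
  Subtype.val_injective

lemma isUniformizer_unif : IsUniformizer (LocalRing hp) (unif hp) where
  exists_algebraMap_eq := ⟨algebraMap k[X] (LocalRing hp) p, rfl⟩
  not_isUnit a ha h := by
    have h1 := HeightOneSpectrum.adicCompletionIntegers.isUnit_iff_valued_eq_one.mp h
    have h2 : Valued.v (algebraMap k[X] (LocalField hp) p) = 1 := by
      rw [← h1]
      exact congrArg _ ha.symm
    rw [valued_algebraMap_p, ← WithZero.exp_zero, WithZero.exp_inj] at h2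
    omega
  exists_zpow_mul c := exists_p_zpow_mul_unit hp c

lemma algebraMap_localRing_injective : Function.Injective (algebraMap k[X] (LocalRing hp)) := by
  refine Function.Injective.of_comp (f := algebraMap (LocalRing hp) (LocalField hp)) ?_
  rw [← RingHom.coe_comp, ← IsScalarTower.algebraMap_eq,
    IsScalarTower.algebraMap_eq k[X] (RatFunc k) (LocalField hp), RingHom.coe_comp]
  exact (algebraMap (RatFunc k) (LocalField hp)).injective.comp
    (FaithfulSMul.algebraMap_injective k[X] (RatFunc k))

variable {K : Type*} [Fintype k] [Field K] [Algebra k K] [FiniteDimensional k K]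

/-- `K{τ}` is dense in `k[t]_p ⊗ K{τ}`. -/
lemma exists_eq_tmul_add (z : LocalRing hp ⊗[k[X]] SkewPoly k K) (n : ℕ) :
    ∃ f y, z = (1 : LocalRing hp) ⊗ₜ f + algebraMap k[X] (LocalRing hp) p ^ n • y := by
  induction z using TensorProduct.induction_on with
  | zero => exact ⟨0, 0, by simp⟩
  | tmul x f =>
    obtain ⟨a, y, rfl⟩ := exists_sub_mem_p_pow hp x n
    refine ⟨a • f, y ⊗ₜ f, ?_⟩
    rw [TensorProduct.tmul_smul, TensorProduct.smul_tmul', TensorProduct.smul_tmul',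
      ← TensorProduct.add_tmul, Algebra.smul_def, mul_one, smul_eq_mul]
  | add z w hz hw =>
    obtain ⟨f, y, rfl⟩ := hz
    obtain ⟨g, y', rfl⟩ := hw
    exact ⟨f + g, y + y', by rw [TensorProduct.tmul_add, smul_add]; abel⟩

/-- An element of `K{τ}` that is divisible by `p ^ n` locally at `p` is divisible by `p ^ n`. -/
lemma exists_eq_smul_of_tmul_eq {f : SkewPoly k K} {n : ℕ}
    {y : LocalRing hp ⊗[k[X]] SkewPoly k K}
    (h : (1 : LocalRing hp) ⊗ₜ f = algebraMap k[X] (LocalRing hp) p ^ n • y) :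
    ∃ g : SkewPoly k K, f = p ^ n • g := by
  let b := Module.Free.chooseBasis k[X] (SkewPoly k K)
  -- A `k[t]`-basis of `K{τ}` remains a basis over `O`, so divisibility can be tested on
  -- coordinates, where local divisibility by `p ^ n` implies divisibility in `k[t]`.
  have hb : ∀ i, p ^ n ∣ b.repr f i := fun i => by
    refine p_pow_dvd_of_dvd hp _ n ⟨(Algebra.TensorProduct.basis (LocalRing hp) b).repr y i, ?_⟩
    have := congrArg (fun z => (Algebra.TensorProduct.basis (LocalRing hp) b).repr z i) h
    simp only [map_smul, Finsupp.smul_apply, smul_eq_mul] at this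
    rw [← this]
    simp [Algebra.TensorProduct.basis_repr_tmul]
  choose c hc using hb
  refine ⟨∑ i, c i • b i, ?_⟩
  rw [Finset.smul_sum]
  refine (b.sum_repr f).symm.trans (Finset.sum_congr rfl fun i _ => ?_)
  rw [hc, mul_smul]

lemma tmul_injective :
    Function.Injective fun f : SkewPoly k K => (1 : LocalRing hp) ⊗ₜ[k[X]] f :=
  Algebra.TensorProduct.includeRight_injective algebraMap_localRing_injective

end Arithmetic

/-! ### Simple transitivity of `Γ(τ)` on the vertices -/

section Arithmetic

variable {k K : Type*} [Field k] [Fintype k] [Field K] [Algebra k K] [FiniteDimensional k K]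
variable {p : k[X]} {hp : Irreducible p}

instance : NeZero (Module.finrank k K) := ⟨Module.finrank_pos.ne'⟩

lemma commute_algebraMap_p (f : SkewPoly k K) (n : ℕ) :
    algebraMap k[X] (SkewPoly k K) p ^ n * f = f * algebraMap k[X] (SkewPoly k K) p ^ n := by
  rw [← map_pow, Algebra.commutes]

/-- A lattice between `p ^ n O ^ d` and `O ^ d` is the image of `O ^ d` under an element of `K{τ}`
which divides `p ^ n`. -/
lemma exists_skew_generator (Φ : LocalSplitting k K hp) (n : ℕ)
    (N : Submodule (LocalRing hp) (Fin (Module.finrank k K) → LocalRing hp))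
    (hN : ∀ y, algebraMap k[X] (LocalRing hp) p ^ n • y ∈ N) :
    ∃ f g : SkewPoly k K, f * g = algebraMap k[X] (SkewPoly k K) p ^ n ∧
      ∀ x, x ∈ N ↔ ∃ y, (Φ (1 ⊗ₜ f)).mulVec y = x := by
  have : Finite K := Module.finite_of_finite k
  have hmul : ∀ f g : SkewPoly k K, Φ (1 ⊗ₜ (f * g)) = Φ (1 ⊗ₜ f) * Φ (1 ⊗ₜ g) := fun f g => by
    rw [← map_mul, Algebra.TensorProduct.tmul_mul_tmul, one_mul]
  have hpow : Φ (1 ⊗ₜ (algebraMap k[X] (SkewPoly k K) p ^ n))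
      = algebraMap k[X] (LocalRing hp) p ^ n • (1 : Matrix _ _ (LocalRing hp)) := by
    rw [← map_one Φ, ← map_smul, ← map_pow, ← map_pow, Algebra.TensorProduct.one_def,
      Algebra.algebraMap_eq_smul_one, TensorProduct.tmul_smul, TensorProduct.smul_tmul',
      TensorProduct.smul_tmul', Algebra.smul_def, smul_eq_mul]
  -- The right ideal of all elements that map `O ^ d` into `N`. It contains `p ^ n`, so its
  -- generator `f` divides `p ^ n`.
  let I : AddSubgroup (SkewPoly k K) :=
    { carrier := {f | ∀ y, (Φ (1 ⊗ₜ f)).mulVec y ∈ N}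
      zero_mem' := fun y => by simp
      add_mem' := fun {f g} hf hg y => by
        rw [TensorProduct.tmul_add, map_add, Matrix.add_mulVec]
        exact add_mem (hf y) (hg y)
      neg_mem' := fun {f} hf y => by
        rw [TensorProduct.tmul_neg, map_neg, Matrix.neg_mulVec]
        exact neg_mem (hf y) }
  obtain ⟨f, hf, hfI⟩ := SkewPoly.exists_eq_mul_of_rightIdeal I fun f hf g y => by
    rw [hmul, ← Matrix.mulVec_mulVec]
    exact hf _
  obtain ⟨g, hg⟩ := hfI (algebraMap k[X] (SkewPoly k K) p ^ n) fun y => by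
    rw [hpow, Matrix.smul_mulVec, Matrix.one_mulVec]
    exact hN y
  refine ⟨f, g, hg.symm, fun x => ⟨fun hx => ?_, ?_⟩⟩
  -- The matrix with column `x` at index `0` and zeros elsewhere maps `O ^ d` into `N`. Approximate
  -- it by `h ∈ K{τ}` modulo `p ^ n`; the error also maps into `N`, so `h = f h'`. As `p ^ n = f g`,
  -- the error is a right multiple of `f` too, and `x` lies in the image of `f`.
  · obtain ⟨h, B, hB⟩ := exists_eq_tmul_add (Φ.symm (Matrix.vecMulVec x (Pi.single 0 1))) n
    have hA := congrArg Φ hB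
    rw [AlgEquiv.apply_symm_apply, map_add, map_smul] at hA
    have hh : h ∈ I := fun y => by
      have h1 : (Φ (1 ⊗ₜ h)).mulVec y = y 0 • x
          - algebraMap k[X] (LocalRing hp) p ^ n • (Φ B).mulVec y := by
        rw [eq_sub_iff_add_eq, ← Matrix.smul_mulVec, ← Matrix.add_mulVec, ← hA,
          Matrix.vecMulVec_mulVec]
        simp
      rw [h1]
      exact sub_mem (N.smul_mem _ hx) (hN _)
    obtain ⟨h', rfl⟩ := hfI h hh
    refine ⟨(Φ (1 ⊗ₜ h') + Φ (1 ⊗ₜ g) * Φ B).mulVec (Pi.single 0 1), ?_⟩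
    rw [Matrix.mulVec_mulVec, mul_add, ← mul_assoc, ← hmul, ← hmul, ← hg, hpow, smul_mul_assoc,
      one_mul, ← hA, Matrix.vecMulVec_mulVec]
    simp
  · rintro ⟨y, rfl⟩
    exact hf y

omit [Fintype k] in
lemma algebraMap_away_mul_invSelf (n : ℕ) :
    (algebraMap k[X] (Localization.Away p) p) ^ n * IsLocalization.Away.invSelf p ^ n = 1 := by
  rw [← mul_pow, IsLocalization.Away.mul_invSelf, one_pow]

/-- A divisor of `p ^ n` in `K{τ}` is a unit of `K{τ}[1/p]`. -/
lemma exists_unit_eq_tmul {f g : SkewPoly k K} {n : ℕ} (hp : Irreducible p)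
    (h : f * g = algebraMap k[X] (SkewPoly k K) p ^ n) :
    ∃ u : (LocSkewPoly k K p)ˣ, (u : LocSkewPoly k K p) = 1 ⊗ₜ f := by
  have h0 : algebraMap k[X] (SkewPoly k K) p ^ n ≠ 0 :=
    pow_ne_zero _ ((map_ne_zero_iff _ SkewPoly.algebraMap_injective).mpr hp.ne_zero)
  have hf : f ≠ 0 := by rintro rfl; exact h0 (by rw [← h, zero_mul])
  -- Since `p ^ n` is central, `f (g f) = p ^ n f = f p ^ n`, and `f` can be cancelled.
  have h' : g * f = algebraMap k[X] (SkewPoly k K) p ^ n := by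
    apply mul_left_cancel₀ hf
    rw [← mul_assoc, h, commute_algebraMap_p]
  have h1 : (IsLocalization.Away.invSelf p ^ n : Localization.Away p) ⊗ₜ[k[X]]
      (algebraMap k[X] (SkewPoly k K) p ^ n) = 1 := by
    rw [← map_pow, Algebra.algebraMap_eq_smul_one, TensorProduct.tmul_smul,
      TensorProduct.smul_tmul', Algebra.smul_def, map_pow, algebraMap_away_mul_invSelf]
    rfl
  exact ⟨⟨1 ⊗ₜ f, (IsLocalization.Away.invSelf p ^ n) ⊗ₜ g,
    by rw [Algebra.TensorProduct.tmul_mul_tmul, one_mul, h, h1],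
    by rw [Algebra.TensorProduct.tmul_mul_tmul, mul_one, h', h1]⟩, rfl⟩

variable {hp0 : p.eval 0 ≠ 0}

lemma mem_gammaTau_iff (u : (LocSkewPoly k K p)ˣ) : (u : GammaOne k K p) ∈ GammaTau k K hp0 ↔
    ∃ c : kˣ, algebraMap k K c = skewEvalZero k K hp0 u := by
  rw [GammaTau, MonoidHom.mem_ker, gammaEvalZero]
  refine (QuotientGroup.eq_one_iff (N := baseUnits k K) _).trans (exists_congr fun c => ?_)
  rw [Units.ext_iff]
  rfl

lemma skewToMatrix_apply (Φ : LocalSplitting k K hp) (f : SkewPoly k K) :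
    skewToMatrix Φ f = (Φ (1 ⊗ₜ f)).map (algebraMap (LocalRing hp) (LocalField hp)) := rfl

lemma skewToMatrix_injective (Φ : LocalSplitting k K hp) :
    Function.Injective (skewToMatrix Φ) := fun f g h => by
  rw [skewToMatrix_apply, skewToMatrix_apply] at h
  exact tmul_injective (Φ.injective (Matrix.map_injective algebraMap_localField_injective h))

lemma locSkewToMatrix_one_tmul (Φ : LocalSplitting k K hp) (f : SkewPoly k K) :
    locSkewToMatrix Φ (1 ⊗ₜ f) = skewToMatrix Φ f := by
  rw [locSkewToMatrix_tmul, map_one, map_one, one_mul]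

/-- Every lattice in `L₀` is the image of `L₀` under an element of `Γ(τ)`. -/
lemma exists_isGamma (Φ : LocalSplitting k K hp) {L : Lat k K hp} (hL : L ≤ stdLat k K hp) :
    ∃ γ : GammaTau k K hp0, IsGamma Φ L γ := by
  obtain ⟨n, hn⟩ := isUniformizer_unif.exists_scale_le L (stdLat k K hp)
  obtain ⟨f, g, hfg, hf⟩ := exists_skew_generator Φ n
    (L.1.comap ((Algebra.linearMap (LocalRing hp) (LocalField hp)).compLeft _)) fun y => by
      refine hn (Lattice.mem_scale.mpr ⟨_, Lattice.mem_std.mpr ⟨y, rfl⟩, ?_⟩)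
      funext i
      simp only [Pi.smul_apply, smul_eq_mul, Units.val_pow_eq_pow_val]
      refine ((map_mul (algebraMap (LocalRing hp) (LocalField hp)) _ _).trans ?_).symm
      rw [map_pow]
      rfl
  -- Normalize the value at `τ = 0` to `1` by the constant `a⁻¹` on the right, where it acts on `L₀`
  -- through `GL (d, O)` and leaves the image unchanged. Here `a ≠ 0` because `f` divides `p ^ n`
  -- and `p(0) ≠ 0`.
  set a := SkewPoly.evalZero k K f with ha
  have ha0 : a ≠ 0 := by
    have := congrArg (SkewPoly.evalZero k K) hfg
    rw [map_mul, map_pow, SkewPoly.evalZero_algebraMap] at this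
    exact left_ne_zero_of_mul (this ▸ pow_ne_zero n (by simpa using hp0))
  obtain ⟨u, hu⟩ := exists_unit_eq_tmul (f := f * SkewPoly.C k K a⁻¹)
    (g := SkewPoly.C k K a * g) (n := n) hp (by
      rw [mul_assoc, ← mul_assoc _ _ g, ← map_mul, inv_mul_cancel₀ ha0, map_one, one_mul, hfg])
  have hC : Φ (1 ⊗ₜ SkewPoly.C k K a⁻¹) * Φ (1 ⊗ₜ SkewPoly.C k K a) = 1 := by
    rw [← map_mul, Algebra.TensorProduct.tmul_mul_tmul, ← map_mul, inv_mul_cancel₀ ha0, map_one,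
      one_mul, ← Algebra.TensorProduct.one_def, map_one]
  have hmul : Φ (1 ⊗ₜ (f * SkewPoly.C k K a⁻¹)) = Φ (1 ⊗ₜ f) * Φ (1 ⊗ₜ SkewPoly.C k K a⁻¹) := by
    rw [← map_mul, Algebra.TensorProduct.tmul_mul_tmul, one_mul]
  refine ⟨⟨(u : GammaOne k K p), (mem_gammaTau_iff u).mpr ⟨1, ?_⟩⟩, u, _, rfl, hu, ?_⟩
  · rw [hu, skewEvalZero_tmul, map_one, map_one, one_mul, map_mul, SkewPoly.evalZero_C, ← ha,
      mul_inv_cancel₀ ha0, Units.val_one, map_one]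
  · have huM : (unitsToGL Φ u).1 = (Φ (1 ⊗ₜ f) * Φ (1 ⊗ₜ SkewPoly.C k K a⁻¹)).map
        (algebraMap (LocalRing hp) (LocalField hp)) := by
      change locSkewToMatrix Φ u = _
      rw [hu, locSkewToMatrix_one_tmul, skewToMatrix_apply, hmul]
    apply Lattice.ext
    ext x
    rw [Lattice.mem_smul, huM]
    constructor
    · rintro ⟨z, hz, rfl⟩
      obtain ⟨y, rfl⟩ := Lattice.mem_std.mp hz
      have := (hf _).mpr ⟨(Φ (1 ⊗ₜ SkewPoly.C k K a⁻¹)).mulVec y, rfl⟩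
      rw [Matrix.mulVec_mulVec] at this
      convert! Submodule.mem_comap.mp this using 1
      funext i
      exact (RingHom.map_mulVec (algebraMap (LocalRing hp) (LocalField hp)) _ y i).symm
    · intro hx
      obtain ⟨x, rfl⟩ := Lattice.mem_std.mp (hL hx)
      obtain ⟨y, rfl⟩ := (hf x).mp hx
      refine ⟨_, Lattice.mem_std.mpr ⟨(Φ (1 ⊗ₜ SkewPoly.C k K a)).mulVec y, rfl⟩, ?_⟩
      funext i
      refine (RingHom.map_mulVec (algebraMap (LocalRing hp) (LocalField hp)) _ _ i).symm.trans ?_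
      rw [Matrix.mulVec_mulVec, mul_assoc, hC, mul_one]
      rfl

lemma IsGamma.gammaAct_eq {Φ : LocalSplitting k K hp} {L : Lat k K hp} {γ : GammaTau k K hp0}
    (h : IsGamma Φ L γ) : gammaAct Φ γ (Vertex.mk (stdLat k K hp)) = Vertex.mk L := by
  obtain ⟨u, f, hu, -, rfl⟩ := h
  rw [← hu, gammaAct_mk]

/-- A power of `p` moves any lattice into `L₀` without changing its vertex. -/
lemma exists_gammaAct_eq (Φ : LocalSplitting k K hp) (x : Vert k K hp) :
    ∃ γ : GammaTau k K hp0, gammaAct Φ γ (Vertex.mk (stdLat k K hp)) = x := by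
  obtain ⟨L, rfl⟩ := Vertex.exists_mk x
  obtain ⟨n, hn⟩ := isUniformizer_unif.exists_scale_le (stdLat k K hp) L
  obtain ⟨γ, hγ⟩ := exists_isGamma (hp0 := hp0) Φ hn
  exact ⟨γ, by rw [hγ.gammaAct_eq, Vertex.mk_scale]⟩

/-- Every element of `K{τ}[1/p]` has a denominator `p ^ n`. -/
lemma exists_p_pow_smul_eq (z : LocSkewPoly k K p) :
    ∃ (n : ℕ) (f : SkewPoly k K), p ^ n • z = 1 ⊗ₜ f := by
  induction z using TensorProduct.induction_on with
  | zero => exact ⟨0, 0, by simp⟩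
  | tmul c f =>
    obtain ⟨n, a, h⟩ := IsLocalization.Away.surj p c
    refine ⟨n, a • f, ?_⟩
    rw [TensorProduct.tmul_smul, TensorProduct.smul_tmul', TensorProduct.smul_tmul',
      Algebra.smul_def a, mul_one, ← h, Algebra.smul_def, map_pow, mul_comm]
  | add z w hz hw =>
    obtain ⟨n, f, hf⟩ := hz
    obtain ⟨m, g, hg⟩ := hw
    refine ⟨n + m, p ^ m • f + p ^ n • g, ?_⟩
    rw [TensorProduct.tmul_add, smul_add, TensorProduct.tmul_smul, TensorProduct.tmul_smul, ← hf,
      ← hg, smul_smul, smul_smul, pow_add, mul_comm (p ^ n)]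

lemma p_pow_smul_injective (n : ℕ) : Function.Injective fun z : LocSkewPoly k K p => p ^ n • z := by
  refine Function.LeftInverse.injective
    (g := fun z => (IsLocalization.Away.invSelf p ^ n : Localization.Away p) • z) fun z => ?_
  change _ • p ^ n • z = z
  rw [← algebraMap_smul (Localization.Away p) (p ^ n) z, smul_smul, map_pow, mul_comm,
    algebraMap_away_mul_invSelf, one_smul]

/-- The elements of `K{τ}[1/p]` that are integral at `p` belong to `K{τ}`. -/
lemma exists_eq_tmul_of_integral (Φ : LocalSplitting k K hp) {z : LocSkewPoly k K p}
    {B : Matrix (Fin (Module.finrank k K)) (Fin (Module.finrank k K)) (LocalRing hp)}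
    (h : locSkewToMatrix Φ z = B.map (algebraMap (LocalRing hp) (LocalField hp))) :
    ∃ f, z = 1 ⊗ₜ f := by
  obtain ⟨n, f, hf⟩ := exists_p_pow_smul_eq z
  have h1 := congrArg (locSkewToMatrix Φ) hf
  rw [map_smul, h, locSkewToMatrix_one_tmul, skewToMatrix_apply] at h1
  have h2 : algebraMap k[X] (LocalRing hp) p ^ n • B = Φ (1 ⊗ₜ f) := by
    apply Matrix.map_injective algebraMap_localField_injective
    refine Eq.trans ?_ h1
    ext i j : 2
    simp only [Matrix.map_apply, Matrix.smul_apply, smul_eq_mul, map_mul, map_pow]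
    rw [Algebra.smul_def, map_pow]
    rfl
  -- The numerator `f = p ^ n z` is divisible by `p ^ n` over `O`, hence already in `K{τ}`;
  -- cancelling `p ^ n` shows `z ∈ K{τ}`.
  obtain ⟨g, rfl⟩ := exists_eq_smul_of_tmul_eq (hp := hp) (f := f) (n := n) (y := Φ.symm B) (by
    apply Φ.injective
    rw [map_smul, AlgEquiv.apply_symm_apply, h2])
  refine ⟨g, p_pow_smul_injective n ?_⟩
  change p ^ n • z = p ^ n • _
  rw [hf, TensorProduct.tmul_smul]

/-- The element `p` of `K{τ}[1/p]ˣ`. -/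
def pUnit (k K : Type*) [Field k] [Fintype k] [Field K] [Algebra k K] [FiniteDimensional k K]
    (p : k[X]) : (LocSkewPoly k K p)ˣ :=
  Units.map (algebraMap (Localization.Away p) (LocSkewPoly k K p)).toMonoidHom
    (IsLocalization.Away.algebraMap_isUnit p).unit

lemma pUnit_mem : pUnit k K p ∈ centralUnits k K p := ⟨_, rfl⟩

lemma unitsToGL_pUnit_smul (Φ : LocalSplitting k K hp) (L : Lat k K hp) :
    unitsToGL Φ (pUnit k K p) • L = L.scale (unif hp) := by
  have h : (unitsToGL Φ (pUnit k K p)).1 = algebraMap _ _ (algebraMap k[X] (LocalField hp) p) := by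
    change locSkewToMatrix Φ ((algebraMap k[X] (Localization.Away p) p) ⊗ₜ 1) = _
    rw [locSkewToMatrix_tmul, map_one, mul_one, AlgHom.commutes]
  apply Lattice.ext
  ext x
  rw [Lattice.mem_smul, Lattice.mem_scale, h]
  refine exists_congr fun y => and_congr_right fun _ => ?_
  rw [Algebra.algebraMap_eq_smul_one, Matrix.smul_mulVec, Matrix.one_mulVec]
  rfl

lemma unitsToGL_pUnit_zpow_smul (Φ : LocalSplitting k K hp) (L : Lat k K hp) (j : ℤ) :
    unitsToGL Φ (pUnit k K p ^ j) • L = L.scale (unif hp ^ j) := by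
  induction j with
  | zero => simp [Lattice.scale_one]
  | succ j ih =>
    rw [zpow_add_one, map_mul, mul_smul, unitsToGL_pUnit_smul, Lattice.smul_scale, ih,
      Lattice.scale_scale, ← zpow_one_add, add_comm]
  | pred j ih =>
    rw [zpow_sub_one, map_mul, mul_smul, map_inv]
    have : (unitsToGL Φ (pUnit k K p))⁻¹ • L = L.scale (unif hp)⁻¹ := by
      rw [inv_smul_eq_iff, unitsToGL_pUnit_smul, Lattice.scale_scale, mul_inv_cancel,
        Lattice.scale_one]
    rw [this, Lattice.smul_scale, ih, Lattice.scale_scale, zpow_sub_one, mul_comm]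

/-- The stabilizer of `⟨L₀⟩` in `Γ(τ)` is trivial. -/
lemma eq_one_of_gammaAct_eq (Φ : LocalSplitting k K hp) (γ : GammaTau k K hp0)
    (h : gammaAct Φ γ (Vertex.mk (stdLat k K hp)) = Vertex.mk (stdLat k K hp)) : γ = 1 := by
  obtain ⟨γ, hγ⟩ := γ
  obtain ⟨u, rfl⟩ := QuotientGroup.mk_surjective γ
  rw [gammaAct_mk] at h
  obtain ⟨j, hj⟩ := isUniformizer_unif.exists_eq_scale_zpow h
  -- Replace `u` by a central multiple that fixes the lattice `L₀` and not only its class.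
  obtain ⟨v, hv⟩ : ∃ v, v = pUnit k K p ^ j * u := ⟨_, rfl⟩
  have hvL : unitsToGL Φ v • stdLat k K hp = stdLat k K hp := by
    rw [hv, map_mul, mul_smul, unitsToGL_pUnit_zpow_smul, ← hj]
  have hvu : (v : GammaOne k K p) = u := by
    rw [hv, QuotientGroup.mk_mul, (QuotientGroup.eq_one_iff _).mpr (zpow_mem pUnit_mem j), one_mul]
  have hvL' : unitsToGL Φ v⁻¹ • stdLat k K hp = stdLat k K hp := by
    rw [map_inv, inv_smul_eq_iff, hvL]
  -- Both `v` and `v⁻¹` are integral at `p`, so they lie in `K{τ}` and `v` is a constant. The kernel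
  -- condition puts this constant in `k`, where it is central.
  obtain ⟨B, hB⟩ := Lattice.smul_std_le_iff.mp hvL.le
  obtain ⟨B', hB'⟩ := Lattice.smul_std_le_iff.mp hvL'.le
  obtain ⟨f, hf⟩ := exists_eq_tmul_of_integral Φ (z := v) hB
  obtain ⟨g, hg⟩ := exists_eq_tmul_of_integral Φ (z := (v⁻¹ : (LocSkewPoly k K p)ˣ)) hB'
  have hfg : f * g = 1 := by
    apply skewToMatrix_injective Φ
    rw [map_mul, map_one, ← locSkewToMatrix_one_tmul, ← locSkewToMatrix_one_tmul, ← hf, ← hg,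
      ← map_mul, Units.mul_inv, map_one]
  obtain ⟨a, rfl⟩ := SkewPoly.eq_C_of_mul_eq_one hfg
  change (u : GammaOne k K p) ∈ _ at hγ
  rw [← hvu] at hγ
  obtain ⟨c, hc⟩ := (mem_gammaTau_iff v).mp hγ
  rw [hf, skewEvalZero_tmul, map_one, map_one, one_mul, SkewPoly.evalZero_C] at hc
  apply Subtype.ext
  change (u : GammaOne k K p) = 1
  rw [← hvu]
  refine (QuotientGroup.eq_one_iff v).mpr ((mem_centralUnits k K p).mpr
    ⟨Units.map (algebraMap k[X] (Localization.Away p)).toMonoidHom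
      (Units.map (Polynomial.C : k →+* k[X]).toMonoidHom c), ?_⟩)
  rw [hf, ← hc, ← SkewPoly.algebraMap_C]
  change algebraMap k[X] (Localization.Away p) (Polynomial.C (c : k)) ⊗ₜ 1 = _
  rw [Algebra.algebraMap_eq_smul_one (A := SkewPoly k K), TensorProduct.tmul_smul,
    TensorProduct.smul_tmul', Algebra.smul_def, mul_one]

lemma gammaAct_injective (Φ : LocalSplitting k K hp) :
    Function.Injective fun γ : GammaTau k K hp0 => gammaAct Φ γ (Vertex.mk (stdLat k K hp)) := by
  intro γ γ' h
  have h : gammaAct Φ γ (Vertex.mk (stdLat k K hp)) = gammaAct Φ γ' (Vertex.mk (stdLat k K hp)) := h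
  refine (inv_mul_eq_one.mp (eq_one_of_gammaAct_eq Φ (γ⁻¹ * γ') ?_))
  rw [Subgroup.coe_mul, Subgroup.coe_inv, map_mul, map_inv, Equiv.Perm.mul_apply, ← h]
  exact (gammaAct Φ (γ : GammaOne k K p)).symm_apply_apply _

lemma existsUnique_isGamma (Φ : LocalSplitting k K hp) {L : Lat k K hp}
    (hL : L ≤ stdLat k K hp) : ∃! γ : GammaTau k K hp0, IsGamma Φ L γ := by
  obtain ⟨γ, hγ⟩ := exists_isGamma (hp0 := hp0) Φ hL
  exact ⟨γ, hγ, fun γ' hγ' => gammaAct_injective Φ (hγ'.gammaAct_eq.trans hγ.gammaAct_eq.symm)⟩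

end Arithmetic

/-! ### Images of complexes and of Cayley graphs -/

section Complexes

variable {V W U : Type*}

lemma mem_imageComplex {X : PreAbstractSimplicialComplex V} {f : V → W} {s : Finset W} :
    s ∈ (imageComplex X f).faces ↔ ∃ t ∈ X.faces, (s : Set W) = f '' t := by
  classical
  constructor
  · rintro ⟨t, ht, rfl⟩
    exact ⟨t, ht, by ext; simp⟩
  · rintro ⟨t, ht, h⟩
    exact ⟨t, ht, by ext; simp [← Finset.mem_coe (s := s), h]⟩

lemma imageComplex_imageComplex (X : PreAbstractSimplicialComplex V) (f : V → W) (g : W → U) :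
    imageComplex (imageComplex X f) g = imageComplex X (g ∘ f) := by
  classical
  ext s
  rw [mem_imageComplex, mem_imageComplex]
  constructor
  · rintro ⟨t, ht, hs⟩
    obtain ⟨r, hr, h⟩ := mem_imageComplex.mp ht
    exact ⟨r, hr, by rw [hs, h, Set.image_comp]⟩
  · rintro ⟨r, hr, hs⟩
    exact ⟨r.image f, mem_imageComplex.mpr ⟨r, hr, Finset.coe_image⟩, by
      rw [hs, Finset.coe_image, Set.image_comp]⟩

/-- An edge of the image may come from a larger simplex; choosing in it one preimage of each
endpoint gives a face, and `a ≠ b` keeps the preimages distinct. -/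
lemma oneSkeleton_imageComplex_adj {X : PreAbstractSimplicialComplex V} {f : V → W} {a b : W} :
    (oneSkeleton (imageComplex X f)).Adj a b ↔
      a ≠ b ∧ ∃ x y, f x = a ∧ f y = b ∧ (oneSkeleton X).Adj x y := by
  classical
  refine and_congr_right fun hab => ?_
  constructor
  · rintro ⟨s, hs, hsab⟩
    obtain ⟨t, ht, hst⟩ := mem_imageComplex.mp hs
    obtain ⟨x, hx, rfl⟩ : a ∈ f '' t := by rw [← hst, hsab]; simp
    obtain ⟨y, hy, rfl⟩ : b ∈ f '' t := by rw [← hst, hsab]; simp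
    refine ⟨x, y, rfl, rfl, fun h => hab (congrArg f h), {x, y}, ?_, by simp⟩
    refine (X.isRelLowerSet_faces ht).2 ?_ (by simp)
    intro z hz
    rcases Finset.mem_insert.mp hz with rfl | hz
    · exact hx
    · rwa [Finset.mem_singleton.mp hz]
  · rintro ⟨x, y, rfl, rfl, -, s, hs, hsxy⟩
    exact ⟨s.image f, mem_imageComplex.mpr ⟨s, hs, Finset.coe_image⟩, by
      rw [Finset.coe_image, hsxy, Set.image_pair]⟩

/-- A complex whose simplices are the sets of pairwise adjacent vertices is the clique complex of a
graph. -/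
lemma imageComplex_cliqueComplex_eq {G : SimpleGraph V} {X : PreAbstractSimplicialComplex W}
    (e : V ≃ W) (h : ∀ s, s ∈ X.faces ↔
      s.Nonempty ∧ (s : Set W).Pairwise fun x y => G.Adj (e.symm x) (e.symm y)) :
    imageComplex (cliqueComplex G) e = X := by
  classical
  ext s
  rw [mem_imageComplex, h]
  constructor
  · rintro ⟨t, ⟨hne, ht⟩, hs⟩
    rw [← Finset.coe_nonempty, hs]
    refine ⟨hne.to_set.image e, ?_⟩
    rintro _ ⟨x, hx, rfl⟩ _ ⟨y, hy, rfl⟩ hxy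
    rw [e.symm_apply_apply, e.symm_apply_apply]
    exact ht hx hy fun h => hxy (congrArg e h)
  · rintro ⟨hne, hs⟩
    refine ⟨s.image e.symm, ⟨hne.image _, ?_⟩, ?_⟩
    · rw [Finset.coe_image]
      rintro _ ⟨x, hx, rfl⟩ _ ⟨y, hy, rfl⟩ hxy
      exact hs hx hy fun h => hxy (congrArg e.symm h)
    · rw [Finset.coe_image, ← Set.image_comp, Equiv.self_comp_symm, Set.image_id]

/-- An edge lifts from any chosen lift of its starting point. The condition `a ≠ b` discards the
loops that generators from `N` would create. -/
lemma mulCayley_image_adj {G : Type*} [Group G] (N : Subgroup G) [N.Normal] (S : Set G)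
    {a b : G ⧸ N} : (SimpleGraph.mulCayley (QuotientGroup.mk' N '' S)).Adj a b ↔
      a ≠ b ∧ ∃ x y, QuotientGroup.mk' N x = a ∧ QuotientGroup.mk' N y = b ∧
        (SimpleGraph.mulCayley S).Adj x y := by
  rw [SimpleGraph.mulCayley_adj']
  refine and_congr_right fun hab => ?_
  simp only [SimpleGraph.mulCayley_adj']
  constructor
  · rintro ⟨_, ⟨s, hs, rfl⟩, h | h⟩
    · obtain ⟨x, rfl⟩ := QuotientGroup.mk'_surjective N a
      rw [← map_mul] at h
      exact ⟨x, x * s, rfl, h, fun hx => hab (h ▸ congrArg _ hx), s, hs, Or.inl rfl⟩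
    · obtain ⟨x, rfl⟩ := QuotientGroup.mk'_surjective N b
      rw [← map_mul] at h
      exact ⟨x * s, x, h.symm, rfl, fun hx => hab (h.trans (congrArg _ hx)), s, hs, Or.inr rfl⟩
  · rintro ⟨x, y, rfl, rfl, -, s, hs, rfl | rfl⟩
    · exact ⟨_, ⟨s, hs, rfl⟩, Or.inl (map_mul _ _ _).symm⟩
    · exact ⟨_, ⟨s, hs, rfl⟩, Or.inr (map_mul _ _ _)⟩

/-- No distinctness is required here, since in the quotient a loop may carry a label. -/
lemma cayleyLabel_image_iff {G : Type*} [Group G] (N : Subgroup G) [N.Normal] (S : ℕ → Set G)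
    {a b : G ⧸ N} {i : ℕ} : cayleyLabel (fun j => QuotientGroup.mk' N '' S j) a b i ↔
      imageLabel (cayleyLabel S) (QuotientGroup.mk' N) a b i := by
  constructor
  · rintro ⟨_, ⟨s, hs, rfl⟩, rfl⟩
    obtain ⟨x, rfl⟩ := QuotientGroup.mk'_surjective N a
    exact ⟨x, x * s, rfl, map_mul _ _ _, s, hs, rfl⟩
  · rintro ⟨x, _, rfl, rfl, s, hs, rfl⟩
    exact ⟨_, ⟨s, hs, rfl⟩, (map_mul _ _ _).symm⟩

end Complexes

/-! ### The isomorphisms for the building and for its quotient -/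

section Action

variable {k K : Type*} [Field k] [Fintype k] [Field K] [Algebra k K] [FiniteDimensional k K]
variable {p : k[X]} {hp : Irreducible p} {hp0 : p.eval 0 ≠ 0}
variable (Φ : LocalSplitting k K hp)

lemma neighbors_gammaAct_iff (γ : GammaOne k K p) (x y : Vert k K hp) :
    Neighbors (unif hp) (gammaAct Φ γ x) (gammaAct Φ γ y) ↔ Neighbors (unif hp) x y := by
  have key : ∀ (γ : GammaOne k K p) (x y : Vert k K hp), Neighbors (unif hp) x y →
      Neighbors (unif hp) (gammaAct Φ γ x) (gammaAct Φ γ y) := by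
    rintro γ _ _ ⟨L, M, rfl, rfl, h⟩
    obtain ⟨u, rfl⟩ := QuotientGroup.mk_surjective γ
    exact ⟨_, _, rfl, rfl, h.smul (unitsToGL Φ u)⟩
  refine ⟨fun h => ?_, key γ x y⟩
  simpa only [← Equiv.Perm.mul_apply, ← map_mul, inv_mul_cancel, map_one, Equiv.Perm.one_apply]
    using key γ⁻¹ _ _ h

lemma buildingLabel_gammaAct_iff (γ : GammaOne k K p) (x y : Vert k K hp) (i : ℕ) :
    buildingLabel (unif hp) (gammaAct Φ γ x) (gammaAct Φ γ y) i ↔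
      buildingLabel (unif hp) x y i := by
  have key : ∀ (γ : GammaOne k K p) (x y : Vert k K hp), buildingLabel (unif hp) x y i →
      buildingLabel (unif hp) (gammaAct Φ γ x) (gammaAct Φ γ y) i := by
    rintro γ _ _ ⟨L, M, rfl, rfl, h, hi⟩
    obtain ⟨u, rfl⟩ := QuotientGroup.mk_surjective γ
    exact ⟨_, _, rfl, rfl, h.smul (unitsToGL Φ u), (latticeLabel_smul L M _).trans hi⟩
  refine ⟨fun h => ?_, key γ x y⟩
  simpa only [← Equiv.Perm.mul_apply, ← map_mul, inv_mul_cancel, map_one, Equiv.Perm.one_apply]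
    using key γ⁻¹ _ _ h

variable (hp0) in
/-- The bijection `γ ↦ γ ⟨L₀⟩` from `Γ(τ)` to the vertices of the building. -/
def vertexEquiv : GammaTau k K hp0 ≃ Vert k K hp :=
  Equiv.ofBijective (fun γ => gammaAct Φ γ (Vertex.mk (stdLat k K hp)))
    ⟨gammaAct_injective Φ, exists_gammaAct_eq Φ⟩

lemma vertexEquiv_mul (γ δ : GammaTau k K hp0) :
    vertexEquiv hp0 Φ (γ * δ) = gammaAct Φ γ (vertexEquiv hp0 Φ δ) := by
  change gammaAct Φ (γ * δ : GammaOne k K p) _ = _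
  rw [map_mul]
  rfl

lemma vertexEquiv_one : vertexEquiv hp0 Φ 1 = Vertex.mk (stdLat k K hp) := by
  change gammaAct Φ (1 : GammaOne k K p) (Vertex.mk (stdLat k K hp)) = _
  rw [map_one]
  rfl

/-- By simple transitivity, an element is determined by its effect on `⟨L₀⟩`, so it has the integral
representative already known to exist for `L`. -/
lemma isGamma_iff {L : Lat k K hp} (hL : L ≤ stdLat k K hp) (γ : GammaTau k K hp0) :
    IsGamma Φ L γ ↔ Vertex.mk L = vertexEquiv hp0 Φ γ := by
  refine ⟨fun h => h.gammaAct_eq.symm, fun h => ?_⟩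
  obtain ⟨δ, hδ⟩ := exists_isGamma (hp0 := hp0) Φ hL
  rwa [(vertexEquiv hp0 Φ).injective (h.symm.trans hδ.gammaAct_eq.symm)]

lemma mem_gens_iff (γ : GammaTau k K hp0) : γ ∈ gens Φ hp0 ↔
    Neighbors (unif hp) (vertexEquiv hp0 Φ 1) (vertexEquiv hp0 Φ γ) := by
  rw [vertexEquiv_one]
  constructor
  · rintro ⟨L, hL, h⟩
    exact ⟨_, L, rfl, (isGamma_iff Φ hL.1.le γ).mp h, hL⟩
  · intro h
    obtain ⟨L, h, hL⟩ := h.exists_isNeighbor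
    exact ⟨L, hL, (isGamma_iff Φ hL.1.le γ).mpr h⟩

lemma mem_gensOfLabel_iff (γ : GammaTau k K hp0) (i : ℕ) : γ ∈ gensOfLabel Φ hp0 i ↔
    buildingLabel (unif hp) (vertexEquiv hp0 Φ 1) (vertexEquiv hp0 Φ γ) i := by
  rw [vertexEquiv_one]
  constructor
  · rintro ⟨L, hL, hi, h⟩
    exact ⟨_, L, rfl, (isGamma_iff Φ hL.1.le γ).mp h, hL, hi⟩
  · rintro ⟨N, M, hN, hM, h, hi⟩
    obtain ⟨c, hc, hNc⟩ := exists_isNeighbor_of_mk_eq h hN rfl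
    refine ⟨M.scale c, hc, ?_, (isGamma_iff Φ hc.1.le γ).mpr ((Vertex.mk_scale c M).trans hM)⟩
    rw [hNc, latticeLabel_scale, hi]

/-- The action preserves neighbors, so translating by `γ` reduces every edge to one at `⟨L₀⟩`. -/
lemma inv_mul_mem_gens_iff (γ δ : GammaTau k K hp0) : γ⁻¹ * δ ∈ gens Φ hp0 ↔
    Neighbors (unif hp) (vertexEquiv hp0 Φ γ) (vertexEquiv hp0 Φ δ) := by
  rw [mem_gens_iff, ← neighbors_gammaAct_iff Φ γ, ← vertexEquiv_mul, ← vertexEquiv_mul, mul_one,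
    mul_inv_cancel_left]

lemma mulCayley_gens_adj_iff (γ δ : GammaTau k K hp0) :
    (SimpleGraph.mulCayley (gens Φ hp0)).Adj γ δ ↔
      Neighbors (unif hp) (vertexEquiv hp0 Φ γ) (vertexEquiv hp0 Φ δ) := by
  rw [SimpleGraph.mulCayley_adj']
  constructor
  · rintro ⟨-, s, hs, rfl | rfl⟩
    · rwa [← inv_mul_mem_gens_iff, inv_mul_cancel_left]
    · apply Neighbors.symm
      rwa [← inv_mul_mem_gens_iff, inv_mul_cancel_left]
  · intro h
    refine ⟨?_, _, (inv_mul_mem_gens_iff Φ γ δ).mpr h, Or.inl (mul_inv_cancel_left γ δ)⟩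
    rintro rfl
    obtain ⟨L, M, hL, hM, h⟩ := h
    exact isUniformizer_unif.mk_ne_mk h (hL.trans hM.symm)

lemma mulCayley_gens_adj_iff_oneSkeleton_adj (γ δ : GammaTau k K hp0) :
    (oneSkeleton (bldg k K hp)).Adj (vertexEquiv hp0 Φ γ) (vertexEquiv hp0 Φ δ) ↔
      (SimpleGraph.mulCayley (gens Φ hp0)).Adj γ δ :=
  (isUniformizer_unif.oneSkeleton_adj_iff algebraMap_localField_injective _ _).trans
    (mulCayley_gens_adj_iff Φ γ δ).symm

lemma cayleyLabel_gensOfLabel_iff (γ δ : GammaTau k K hp0) (i : ℕ) :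
    cayleyLabel (gensOfLabel Φ hp0) γ δ i ↔
      buildingLabel (unif hp) (vertexEquiv hp0 Φ γ) (vertexEquiv hp0 Φ δ) i := by
  have h : cayleyLabel (gensOfLabel Φ hp0) γ δ i ↔ γ⁻¹ * δ ∈ gensOfLabel Φ hp0 i := by
    constructor
    · rintro ⟨s, hs, rfl⟩
      rwa [inv_mul_cancel_left]
    · exact fun h => ⟨_, h, mul_inv_cancel_left γ δ⟩
  rw [h, mem_gensOfLabel_iff, ← buildingLabel_gammaAct_iff Φ γ, ← vertexEquiv_mul,
    ← vertexEquiv_mul, mul_one, mul_inv_cancel_left]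

lemma imageComplex_vertexEquiv :
    imageComplex (cliqueComplex (SimpleGraph.mulCayley (gens Φ hp0))) (vertexEquiv hp0 Φ)
      = bldg k K hp := by
  refine imageComplex_cliqueComplex_eq (vertexEquiv hp0 Φ) fun s => ?_
  simp only [mulCayley_gens_adj_iff, Equiv.apply_symm_apply]
  exact isUniformizer_unif.mem_faces_iff algebraMap_localField_injective s

variable (Γ : Subgroup (GammaTau k K hp0)) [Γ.Normal]

/-- Orbits of `Γ` correspond to cosets `Γ γ`, whereas the quotient group consists of cosets `γ Γ`;
normality identifies them. -/
lemma orbitMap_vertexEquiv_eq_iff (γ δ : GammaTau k K hp0) :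
    orbitMap Φ Γ (vertexEquiv hp0 Φ γ) = orbitMap Φ Γ (vertexEquiv hp0 Φ δ) ↔
      (γ : GammaTau k K hp0 ⧸ Γ) = δ := by
  rw [orbitMap_eq_iff, QuotientGroup.eq, ← Subgroup.Normal.mem_comm_iff ‹_›, ← inv_mem_iff,
    mul_inv_rev, inv_inv]
  simp only [← vertexEquiv_mul, (vertexEquiv hp0 Φ).injective.eq_iff]
  constructor
  · rintro ⟨s, hs, rfl⟩
    rwa [mul_inv_cancel_right]
  · exact fun h => ⟨_, h, inv_mul_cancel_right γ δ⟩

/-- The bijection `Γ(τ) / Γ → Γ \ X₀`. -/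
def orbitEquiv : GammaTau k K hp0 ⧸ Γ ≃ QuotVert Φ Γ :=
  Equiv.ofBijective (Quotient.lift (fun γ => orbitMap Φ Γ (vertexEquiv hp0 Φ γ)) fun γ δ h =>
      (orbitMap_vertexEquiv_eq_iff Φ Γ γ δ).mpr (Quotient.sound h))
    ⟨by
      intro a b h
      obtain ⟨γ, rfl⟩ := QuotientGroup.mk_surjective a
      obtain ⟨δ, rfl⟩ := QuotientGroup.mk_surjective b
      exact (orbitMap_vertexEquiv_eq_iff Φ Γ γ δ).mp h, by
      intro x
      obtain ⟨x, rfl⟩ := Quotient.exists_rep x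
      obtain ⟨γ, rfl⟩ := (vertexEquiv hp0 Φ).surjective x
      exact ⟨γ, rfl⟩⟩

lemma orbitEquiv_mk (γ : GammaTau k K hp0) :
    orbitEquiv Φ Γ (QuotientGroup.mk' Γ γ) = orbitMap Φ Γ (vertexEquiv hp0 Φ γ) := rfl

lemma exists_orbitMap_eq_iff (P : Vert k K hp → Vert k K hp → Prop) (a b : GammaTau k K hp0 ⧸ Γ) :
    (∃ x y, orbitMap Φ Γ x = orbitEquiv Φ Γ a ∧ orbitMap Φ Γ y = orbitEquiv Φ Γ b ∧ P x y) ↔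
      ∃ γ δ, QuotientGroup.mk' Γ γ = a ∧ QuotientGroup.mk' Γ δ = b ∧
        P (vertexEquiv hp0 Φ γ) (vertexEquiv hp0 Φ δ) := by
  simp only [← (vertexEquiv hp0 Φ).exists_congr_right, ← orbitEquiv_mk,
    (orbitEquiv Φ Γ).injective.eq_iff]

lemma oneSkeleton_orbitEquiv_adj_iff (a b : GammaTau k K hp0 ⧸ Γ) :
    (oneSkeleton (imageComplex (bldg k K hp) (orbitMap Φ Γ))).Adj
      (orbitEquiv Φ Γ a) (orbitEquiv Φ Γ b) ↔
      (SimpleGraph.mulCayley (QuotientGroup.mk' Γ '' gens Φ hp0)).Adj a b := by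
  rw [oneSkeleton_imageComplex_adj, mulCayley_image_adj, (orbitEquiv Φ Γ).injective.ne_iff,
    exists_orbitMap_eq_iff Φ Γ fun x y => (oneSkeleton (bldg k K hp)).Adj x y]
  simp only [mulCayley_gens_adj_iff_oneSkeleton_adj]

lemma cayleyLabel_orbitEquiv_iff (a b : GammaTau k K hp0 ⧸ Γ) (i : ℕ) :
    cayleyLabel (fun j => QuotientGroup.mk' Γ '' gensOfLabel Φ hp0 j) a b i ↔
      imageLabel (buildingLabel (unif hp)) (orbitMap Φ Γ) (orbitEquiv Φ Γ a)
        (orbitEquiv Φ Γ b) i := by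
  rw [cayleyLabel_image_iff, imageLabel, imageLabel,
    exists_orbitMap_eq_iff Φ Γ fun x y => buildingLabel (unif hp) x y i]
  simp only [cayleyLabel_gensOfLabel_iff]

/-- Both sides are images of the clique complex of `Γ(τ)` under the same map. The simplices of the
quotient are images throughout, so no claim is needed that cliques of the quotient graph lift. -/
lemma imageComplex_orbitEquiv :
    imageComplex (imageComplex (cliqueComplex (SimpleGraph.mulCayley (gens Φ hp0)))
      (QuotientGroup.mk' Γ)) (orbitEquiv Φ Γ) = imageComplex (bldg k K hp) (orbitMap Φ Γ) := by
  rw [← imageComplex_vertexEquiv (hp0 := hp0) Φ, imageComplex_imageComplex,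
    imageComplex_imageComplex]
  rfl

end Action

end

end SkewBuilding

theorem theorem57 (k K : Type*) [Field k] [Fintype k] [Field K] [Algebra k K]
    [FiniteDimensional k K] (p : Polynomial k) (hp : Irreducible p) (hp0 : p.eval 0 ≠ 0)
    (Γ : Subgroup (GammaTau k K hp0)) [Γ.Normal] [Γ.FiniteIndex] :
    Nonempty (LocalSplitting k K hp) ∧
    ∀ Φ : LocalSplitting k K hp,
      (∀ L : Lat k K hp, IsNeighbor (unif hp) (stdLat k K hp) L →
        ∃! γ : GammaTau k K hp0, IsGamma Φ L γ) ∧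
      ∃ (e₀ : SimpleGraph.mulCayley (gens Φ hp0) ≃g oneSkeleton (bldg k K hp))
        (e : SimpleGraph.mulCayley (QuotientGroup.mk' Γ '' gens Φ hp0) ≃g
          oneSkeleton (imageComplex (bldg k K hp) (orbitMap Φ Γ))),
        (∀ γ : GammaTau k K hp0, e₀ γ = gammaAct Φ γ (Vertex.mk (stdLat k K hp))) ∧
        (∀ γ γ' i, cayleyLabel (gensOfLabel Φ hp0) γ γ' i ↔
          buildingLabel (unif hp) (e₀ γ) (e₀ γ') i) ∧
        imageComplex (cliqueComplex (SimpleGraph.mulCayley (gens Φ hp0))) e₀ = bldg k K hp ∧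
        (∀ γ : GammaTau k K hp0, e (QuotientGroup.mk' Γ γ) = orbitMap Φ Γ (e₀ γ)) ∧
        (∀ a b i, cayleyLabel (fun j => QuotientGroup.mk' Γ '' gensOfLabel Φ hp0 j) a b i ↔
          imageLabel (buildingLabel (unif hp)) (orbitMap Φ Γ) (e a) (e b) i) ∧
        imageComplex (imageComplex (cliqueComplex (SimpleGraph.mulCayley (gens Φ hp0)))
            (QuotientGroup.mk' Γ)) e =
          imageComplex (bldg k K hp) (orbitMap Φ Γ) :=
  ⟨nonempty_localSplitting hp hp0, fun Φ =>
    ⟨fun _ hL => existsUnique_isGamma Φ hL.1.le,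
      ⟨vertexEquiv hp0 Φ, fun {γ δ} => mulCayley_gens_adj_iff_oneSkeleton_adj Φ γ δ⟩,
      ⟨orbitEquiv Φ Γ, fun {a b} => oneSkeleton_orbitEquiv_adj_iff Φ Γ a b⟩,
      fun _ => rfl, cayleyLabel_gensOfLabel_iff Φ, imageComplex_vertexEquiv Φ,
      orbitEquiv_mk Φ Γ, cayleyLabel_orbitEquiv_iff Φ Γ, imageComplex_orbitEquiv Φ Γ⟩⟩
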